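/- Theorem (Abstract APS-Theorem). Let $G$ be a group. A $G$-bornological coarse space is a $G$-set with a coarse structure whose invariant entourages are cofinal and a $G$-invariant bornology, such that thickenings of bounded sets by entourages are bounded; morphisms are the equivariant, controlled and proper maps. A $G$-uniform bornological coarse space carries in addition a uniform structure whose invariant entourages are cofinal and some uniform entourage of which is a coarse entourage; its morphisms are moreover uniformly continuous. An equivariant coarse homology theory $E$ is a functor from $G$-bornological coarse spaces to spectra which is coarsely invariant, excisive for equivariant complementary pairs (with $E(\emptyset)\simeq 0$), vanishes on flasques and is u-continuous. Write $E_n(X)=\pi_n(E(X))$. For a $G$-uniform bornological coarse space $X$ let $\mathcal O(X)_-$ be $\mathbb R\otimes X$ with the hybrid coarse structure: its entourages are the entourages $U$ of $\mathbb R\otimes X$ such that for every uniform entourage $V$ there is $n\in\mathbb N$ with $U\subseteq V\cup((-\infty,n]\times X)^2$. Let the cone $\mathcal O(X)$ be the subspace $[0,\infty)\times X$ of $\mathcal O(X)_-$, and embed $X\cong\{0\}\times X\to\mathcal O(X)$. Put $E(\mathcal O^\infty(X))=\mathrm{Cofib}(E(X)\to E(\mathcal O(X)))$ and let $c:E(\mathcal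 O^\infty(X))\to E(\mathcal O(X)_-)$ be the map induced by $\mathcal O(X)\to\mathcal O(X)_-$ and the vanishing of $E$ on $(-\infty,0]\times X$. A symbol of degree $n$ on $X$ is a class in $E_{n+1}(\mathcal O^\infty(X))$. Let $W_\infty$ be a $G$-uniform bornological coarse space with invariant subsets $M_\infty,W$, and let $M=M_\infty\cap W$ (all subsets carry the induced structures). Assume: 1. $(M_\infty,W)$ is coarsely and uniformly excisive, i.e. $M_\infty\cup W=W_\infty$; for every coarse entourage $U$ there is a coarse entourage $V$ with $U[M_\infty]\cap U[W]\subseteq V[M]$; and for every uniform entourage $V$ there is a uniform entourage $U$ with $U[M_\infty]\cap U[W]\subseteq V[M]$. 2. There is an isomorphism $M_\infty\cong[0,\infty)\otimes M$ of $G$-uniform bornological coarse spaces which maps $m\in M$ to $(0,m)$. 3. The inclusion $f:M\to W$ is a coarse equivalence. Let $Y=(-\infty,0]\times W\,\cup\,[0,\infty)\times W_\infty$ with the structures induced from $\mathcal O(W_\infty)_-$. Then $c$ is an equivalence for $X=W_\infty$, and $E$ sends the squares associated to the decompositions $((-\infty,0]\times W,\ [0,\infty)\times W_\infty)$ and $(\mathbb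 R\times W,\ [0,\infty)\times M_\infty)$ of $Y$, whose intersections are $W$ and $\mathcal O(M)$, to cocartesian squares. Hence the map $i:E_{n+1}(Y)\to E_{n+1}(\mathcal O^\infty(W_\infty))$, induced by the inclusion $Y\to\mathcal O(W_\infty)_-$ and $c^{-1}$, and the Mayer-Vietoris boundary maps $\partial:E_{n+1}(Y)\to E_n(W)$ and $\partial':E_{n+1}(Y)\to E_n(\mathcal O(M))$ are defined. (The Mayer-Vietoris boundary of a decomposition $(A,B)$ of $Y$ is $E(Y)\to E(Y)/E(A)\simeq E(B)/E(A\cap B)\to\Sigma E(A\cap B)$.) Moreover, for every integer $n$, every symbol $\sigma$ of degree $n$ on $W_\infty$ and every boundary condition for $\sigma$, i.e. every class $\mathrm{bdc}\in E_{n+1}(Y)$ with $i(\mathrm{bdc})=\sigma$, put $\rho(M)=\partial'(\mathrm{bdc})\in E_n(\mathcal O(M))$ and $\mathrm{Ind}(\sigma,on(W))=\partial(\mathrm{bdc})\in E_n(W)$. Then $$\phi(\rho(M))=\psi(\mathrm{Ind}(\sigma,on(W)))\quad\text{in } E_n(\mathcal O(W)),$$ where $\phi=\mathcal O(f):\mathcal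 O(M)\to\mathcal O(W)$ and $\psi:W\cong\{0\}\times W\to\mathcal O(W)$ are the canonical maps. -/

import Mathlib

open CategoryTheory

universe w u v

namespace CoarseAPS

noncomputable section

/-! ## Bornological coarse spaces with an action of a group -/

/-- A coarse structure on a set `X`: a family of subsets of `X × X`, called (coarse) entourages,
which contains the diagonal and is closed under subsets, finite unions, inverses and
compositions. -/
structure CoarseStructure (X : Type u) where
  entourages : Set (Set (X × X))
  diag_mem : {p : X × X | p.1 = p.2} ∈ entourages
  subset_mem : ∀ {U V : Set (X × X)}, V ∈ entourages → U ⊆ V → U ∈ entourages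
  union_mem : ∀ {U V : Set (X × X)}, U ∈ entourages → V ∈ entourages → U ∪ V ∈ entourages
  inv_mem : ∀ {U : Set (X × X)}, U ∈ entourages → {p : X × X | (p.2, p.1) ∈ U} ∈ entourages
  comp_mem : ∀ {U V : Set (X × X)}, U ∈ entourages → V ∈ entourages →
    {p : X × X | ∃ y, (p.1, y) ∈ U ∧ (y, p.2) ∈ V} ∈ entourages

/-- The `U`-thickening `U[A] = {x | ∃ a ∈ A, (x, a) ∈ U}` of a subset `A`. -/
def thicken {X : Type u} (U : Set (X × X)) (A : Set X) : Set X :=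
  {x | ∃ a ∈ A, (x, a) ∈ U}

/-- Invariance of a subset of `X × X` under the diagonal action of `G`. -/
def IsInvariant (G : Type w) [Group G] {X : Type u} [MulAction G X] (U : Set (X × X)) : Prop :=
  ∀ (g : G) (x y : X), (x, y) ∈ U → (g • x, g • y) ∈ U

/-- `G`-bornological coarse spaces: `G`-sets with a `G`-invariant bornology and a coarse structure
in which the invariant entourages are cofinal, such that thickenings of bounded sets are
bounded. -/
structure GBornCoarse (G : Type w) [Group G] where
  carrier : Type u
  [action : MulAction G carrier]
  [bornology : Bornology carrier]
  coarse : CoarseStructure carrier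
  exists_invariant : ∀ U ∈ coarse.entourages, ∃ V ∈ coarse.entourages, U ⊆ V ∧ IsInvariant G V
  smul_bounded : ∀ (g : G) (B : Set carrier), Bornology.IsBounded B →
    Bornology.IsBounded ((fun x => g • x) '' B)
  thicken_bounded : ∀ U ∈ coarse.entourages, ∀ B : Set carrier, Bornology.IsBounded B →
    Bornology.IsBounded (thicken U B)

attribute [instance] GBornCoarse.action GBornCoarse.bornology

/-- Morphisms of `G`-bornological coarse spaces: equivariant, controlled and proper maps. -/
@[ext]
structure GBornCoarse.Hom {G : Type w} [Group G] (X Y : GBornCoarse.{w, u} G) where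
  toFun : X.carrier → Y.carrier
  equivariant : ∀ (g : G) (x : X.carrier), toFun (g • x) = g • toFun x
  controlled : ∀ U ∈ X.coarse.entourages, (Prod.map toFun toFun) '' U ∈ Y.coarse.entourages
  proper : ∀ B : Set Y.carrier, Bornology.IsBounded B → Bornology.IsBounded (toFun ⁻¹' B)

instance GBornCoarse.category (G : Type w) [Group G] : Category (GBornCoarse.{w, u} G) where
  Hom X Y := GBornCoarse.Hom X Y
  id X :=
    { toFun := id
      equivariant := fun _ _ => rfl
      controlled := fun U hU => by simpa using hU
      proper := fun B hB => hB }
  comp f g :=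
    { toFun := g.toFun ∘ f.toFun
      equivariant := fun a x => by simp [f.equivariant, g.equivariant]
      controlled := fun U hU => by
        have := g.controlled _ (f.controlled U hU)
        rwa [← Set.image_comp, Prod.map_comp_map] at this
      proper := fun B hB => f.proper _ (g.proper B hB) }

@[ext]
theorem GBornCoarse.hom_ext {G : Type w} [Group G] {X Y : GBornCoarse.{w, u} G} {f g : X ⟶ Y}
    (h : ∀ x, f.toFun x = g.toFun x) : f = g :=
  GBornCoarse.Hom.ext (funext h)

section BornCoarse

variable {G : Type w} [Group G]

/-- Two morphisms are close if `{(f x, g x)}` is an entourage. -/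
def IsClose {X Y : GBornCoarse.{w, u} G} (f g : X ⟶ Y) : Prop :=
  {p : Y.carrier × Y.carrier | ∃ x, p = (f.toFun x, g.toFun x)} ∈ Y.coarse.entourages

/-- Coarse equivalences: morphisms which admit an inverse morphism up to closeness. -/
def IsCoarseEquivalence {X Y : GBornCoarse.{w, u} G} (f : X ⟶ Y) : Prop :=
  ∃ g : Y ⟶ X, IsClose (f ≫ g) (𝟙 X) ∧ IsClose (g ≫ f) (𝟙 Y)

/-- Flasque `G`-bornological coarse spaces. -/
def IsFlasque (X : GBornCoarse.{w, u} G) : Prop :=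
  ∃ f : X ⟶ X, IsClose f (𝟙 X) ∧
    (∀ U ∈ X.coarse.entourages,
      (⋃ n : ℕ, (Prod.map f.toFun^[n] f.toFun^[n]) '' U) ∈ X.coarse.entourages) ∧
    ∀ B : Set X.carrier, Bornology.IsBounded B → ∃ n : ℕ, Set.range f.toFun^[n] ∩ B = ∅

/-- The coarse structure induced on a subset. -/
def CoarseStructure.induced {X : Type u} {Z : Type v} (C : CoarseStructure X) (i : Z → X) : CoarseStructure Z where
  entourages := {U | (Prod.map i i) '' U ∈ C.entourages}
  diag_mem := C.subset_mem C.diag_mem (by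
    rintro _ ⟨⟨a, b⟩, h, rfl⟩
    exact congrArg i h)
  subset_mem := fun hV h => C.subset_mem hV (Set.image_mono h)
  union_mem := fun hU hV => by
    simpa only [Set.mem_ofPred_eq, Set.image_union] using C.union_mem hU hV
  inv_mem := fun hU => C.subset_mem (C.inv_mem hU) (by
    rintro _ ⟨⟨a, b⟩, h, rfl⟩
    exact ⟨(b, a), h, rfl⟩)
  comp_mem := fun hU hV => C.subset_mem (C.comp_mem hU hV) (by
    rintro _ ⟨⟨a, b⟩, ⟨y, h, h'⟩, rfl⟩
    exact ⟨i y, ⟨(a, y), h, rfl⟩, ⟨(y, b), h', rfl⟩⟩)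

/-- An invariant subset `S` of `X` with the induced structures. -/
def GBornCoarse.sub (X : GBornCoarse.{w, u} G) (S : SubMulAction G X.carrier) :
    GBornCoarse.{w, u} G where
  carrier := S
  coarse := X.coarse.induced Subtype.val
  exists_invariant := fun U hU => by
    obtain ⟨V, hV, hUV, hinv⟩ := X.exists_invariant _ hU
    refine ⟨(Prod.map Subtype.val Subtype.val) ⁻¹' V,
      X.coarse.subset_mem hV (Set.image_preimage_subset _ _), Set.image_subset_iff.1 hUV, ?_⟩
    intro g x y h
    exact hinv g _ _ h
  smul_bounded := fun g B hB => by
    rw [← Bornology.isBounded_image_subtype_val] at hB ⊢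
    refine (X.smul_bounded g _ hB).subset ?_
    rintro _ ⟨_, ⟨x, hx, rfl⟩, rfl⟩
    exact ⟨x, ⟨x, hx, rfl⟩, rfl⟩
  thicken_bounded := fun U hU B hB => by
    rw [← Bornology.isBounded_image_subtype_val] at hB ⊢
    refine (X.thicken_bounded _ hU _ hB).subset ?_
    rintro _ ⟨x, ⟨a, ha, hxa⟩, rfl⟩
    exact ⟨a, ⟨a, ha, rfl⟩, ⟨(x, a), hxa, rfl⟩⟩

/-- The inclusion of an invariant subset. -/
def GBornCoarse.ι (X : GBornCoarse.{w, u} G) (S : SubMulAction G X.carrier) : X.sub S ⟶ X where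
  toFun := Subtype.val
  equivariant := fun _ _ => rfl
  controlled := fun _ hU => hU
  proper := fun _ hB =>
    Bornology.isBounded_image_subtype_val.1 (hB.subset (Set.image_preimage_subset _ _))

/-- A morphism with values in an invariant subset, as a morphism to that subset. -/
def GBornCoarse.lift {X Y : GBornCoarse.{w, u} G} (f : X ⟶ Y) (T : SubMulAction G Y.carrier)
    (h : ∀ x, f.toFun x ∈ T) : X ⟶ Y.sub T where
  toFun := fun x => ⟨f.toFun x, h x⟩
  equivariant := fun g x => Subtype.ext (f.equivariant g x)
  controlled := fun U hU => Y.coarse.subset_mem (f.controlled U hU) (by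
    rintro _ ⟨_, ⟨p, hp, rfl⟩, rfl⟩
    exact ⟨p, hp, rfl⟩)
  proper := fun B hB => by
    refine (f.proper _ (Bornology.isBounded_image_subtype_val.2 hB)).subset ?_
    intro x hx
    exact ⟨_, hx, rfl⟩

/-- The restriction of a morphism to invariant subsets of source and target. -/
def GBornCoarse.restrict {X Y : GBornCoarse.{w, u} G} (f : X ⟶ Y) (S : SubMulAction G X.carrier)
    (T : SubMulAction G Y.carrier) (h : ∀ x ∈ S, f.toFun x ∈ T) : X.sub S ⟶ Y.sub T :=
  GBornCoarse.lift (X.ι S ≫ f) T (fun x => h x.1 x.2)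

/-- The inclusion of invariant subsets `S ⊆ T`, both with the structures induced from `X`. -/
def GBornCoarse.inclusion {X : GBornCoarse.{w, u} G} {S T : SubMulAction G X.carrier}
    (h : S ≤ T) : X.sub S ⟶ X.sub T :=
  GBornCoarse.lift (X.ι S) T (fun x => h x.2)

/-- Equivariant big families: nonempty directed families of invariant subsets in which every
thickening of a member is contained in a member. -/
structure BigFamily (X : GBornCoarse.{w, u} G) where
  members : Set (SubMulAction G X.carrier)
  nonempty : members.Nonempty
  directed : DirectedOn (· ≤ ·) members
  big : ∀ Y ∈ members, ∀ U ∈ X.coarse.entourages, ∃ Y' ∈ members,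
    thicken U (Y : Set X.carrier) ⊆ (Y' : Set X.carrier)

/-- The coarse structure generated by one entourage. -/
def CoarseStructure.generate {X : Type u} (U : Set (X × X)) : CoarseStructure X where
  entourages := {V | ∀ C : CoarseStructure X, U ∈ C.entourages → V ∈ C.entourages}
  diag_mem := fun C _ => C.diag_mem
  subset_mem := fun hV h C hC => C.subset_mem (hV C hC) h
  union_mem := fun hU hV C hC => C.union_mem (hU C hC) (hV C hC)
  inv_mem := fun hU C hC => C.inv_mem (hU C hC)
  comp_mem := fun hU hV C hC => C.comp_mem (hU C hC) (hV C hC)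

/-- The sets which are contained in an invariant entourage form a coarse structure. -/
def CoarseStructure.invariantPart (G : Type w) [Group G] {X : Type u} [MulAction G X]
    (C : CoarseStructure X) : CoarseStructure X where
  entourages := {U | ∃ V ∈ C.entourages, U ⊆ V ∧ IsInvariant G V}
  diag_mem := ⟨_, C.diag_mem, subset_rfl, fun g x y (h : x = y) => congrArg (g • ·) h⟩
  subset_mem := fun ⟨V, hV, h, hi⟩ h' => ⟨V, hV, h'.trans h, hi⟩
  union_mem := fun ⟨V, hV, h, hi⟩ ⟨V', hV', h', hi'⟩ =>
    ⟨V ∪ V', C.union_mem hV hV', Set.union_subset_union h h', fun g x y hxy =>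
      hxy.imp (hi g x y) (hi' g x y)⟩
  inv_mem := fun ⟨_, hV, h, hi⟩ =>
    ⟨_, C.inv_mem hV, fun _ hp => h hp, fun g x y hxy => hi g y x hxy⟩
  comp_mem := fun ⟨_, hV, h, hi⟩ ⟨_, hV', h', hi'⟩ =>
    ⟨_, C.comp_mem hV hV', fun _ ⟨y, hy, hy'⟩ => ⟨y, h hy, h' hy'⟩,
      fun g _ _ ⟨z, hz, hz'⟩ => ⟨g • z, hi g _ _ hz, hi' g _ _ hz'⟩⟩

/-- The `G`-bornological coarse space `X_U`: the coarse structure of `X` is replaced by the one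
generated by the invariant entourage `U`. -/
def GBornCoarse.atEntourage (X : GBornCoarse.{w, u} G) (U : Set (X.carrier × X.carrier))
    (hU : U ∈ X.coarse.entourages) (hi : IsInvariant G U) : GBornCoarse.{w, u} G where
  carrier := X.carrier
  coarse := CoarseStructure.generate U
  exists_invariant := fun _ hV =>
    hV ((CoarseStructure.generate U).invariantPart G) ⟨U, fun _ hC => hC, subset_rfl, hi⟩
  smul_bounded := X.smul_bounded
  thicken_bounded := fun V hV => X.thicken_bounded V (hV X.coarse hU)

/-- The morphism `X_U → X` given by the identity. -/
def GBornCoarse.fromEntourage (X : GBornCoarse.{w, u} G) (U : Set (X.carrier × X.carrier))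
    (hU : U ∈ X.coarse.entourages) (hi : IsInvariant G U) : X.atEntourage U hU hi ⟶ X where
  toFun := fun x => x
  equivariant := fun _ _ => rfl
  controlled := fun _ hV => X.coarse.subset_mem (hV X.coarse hU) (by
    rintro _ ⟨p, hp, rfl⟩
    exact hp)
  proper := fun _ hB => hB

/-- The morphism `X_U → X_V` given by the identity, for `U ⊆ V`. -/
def GBornCoarse.mapEntourage (X : GBornCoarse.{w, u} G) {U V : Set (X.carrier × X.carrier)}
    (hU : U ∈ X.coarse.entourages) (hi : IsInvariant G U)
    (hV : V ∈ X.coarse.entourages) (hj : IsInvariant G V) (h : U ⊆ V) :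
    X.atEntourage U hU hi ⟶ X.atEntourage V hV hj where
  toFun := fun x => x
  equivariant := fun _ _ => rfl
  controlled := fun W hW C hC => C.subset_mem (hW C (C.subset_mem hC h)) (by
    rintro _ ⟨p, hp, rfl⟩
    exact hp)
  proper := fun _ hB => hB

end BornCoarse

/-! ## Uniform bornological coarse spaces with an action of a group -/

/-- `G`-uniform bornological coarse spaces: `G`-bornological coarse spaces with a uniform structure
in which the invariant uniform entourages are cofinal, such that some coarse entourage is
uniform. -/
structure GUBC (G : Type w) [Group G] extends GBornCoarse.{w, u} G where
  [uniform : UniformSpace carrier]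
  exists_invariant_uniform : ∀ U ∈ uniformity carrier, ∃ V ∈ uniformity carrier,
    V ⊆ U ∧ IsInvariant G V
  compatible : ∃ U ∈ uniformity carrier, U ∈ coarse.entourages

attribute [instance] GUBC.uniform

/-- Morphisms of `G`-uniform bornological coarse spaces. -/
structure GUBC.Hom {G : Type w} [Group G] (X Y : GUBC.{w, u} G) extends
    GBornCoarse.Hom X.toGBornCoarse Y.toGBornCoarse where
  uniformContinuous : UniformContinuous toFun

@[ext]
theorem GUBC.Hom.ext' {G : Type w} [Group G] {X Y : GUBC.{w, u} G} {f g : GUBC.Hom X Y}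
    (h : f.toFun = g.toFun) : f = g := by
  obtain ⟨⟨_, _, _, _⟩, _⟩ := f
  obtain ⟨⟨_, _, _, _⟩, _⟩ := g
  cases h
  rfl

instance GUBC.category (G : Type w) [Group G] : Category (GUBC.{w, u} G) where
  Hom X Y := GUBC.Hom X Y
  id X := { toHom := 𝟙 X.toGBornCoarse, uniformContinuous := uniformContinuous_id }
  comp {X Y Z} f g :=
    { toHom := CategoryStruct.comp (obj := GBornCoarse.{w, u} G)
        (X := X.toGBornCoarse) (Y := Y.toGBornCoarse) (Z := Z.toGBornCoarse) f.toHom g.toHom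
      uniformContinuous := g.uniformContinuous.comp f.uniformContinuous }

section UniformBornCoarse

variable {G : Type w} [Group G]

/-- The morphism of `G`-bornological coarse spaces underlying a morphism of `G`-uniform
bornological coarse spaces. -/
def GUBC.forget {X Y : GUBC.{w, u} G} (f : X ⟶ Y) : X.toGBornCoarse ⟶ Y.toGBornCoarse :=
  GUBC.Hom.toHom f

theorem GUBC.sub_exists_invariant_uniform (X : GUBC.{w, u} G) (S : SubMulAction G X.carrier)
    (U : Set (S × S)) (hU : U ∈ uniformity S) : ∃ V ∈ uniformity S, V ⊆ U ∧ IsInvariant G V := by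
  obtain ⟨V, hV, hVU⟩ := Filter.mem_comap.1 hU
  obtain ⟨V', hV', hVV', hi⟩ := X.exists_invariant_uniform V hV
  exact ⟨_, Filter.preimage_mem_comap hV', fun p hp => hVU (hVV' hp), fun g x y h => hi g _ _ h⟩

theorem GUBC.sub_compatible (X : GUBC.{w, u} G) (S : SubMulAction G X.carrier) :
    ∃ U ∈ uniformity S, U ∈ (X.coarse.induced (Subtype.val : S → X.carrier)).entourages := by
  obtain ⟨U, hU, hU'⟩ := X.compatible
  exact ⟨_, Filter.preimage_mem_comap hU,
    X.coarse.subset_mem hU' (Set.image_preimage_subset _ _)⟩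

/-- An invariant subset of a `G`-uniform bornological coarse space with the induced structures. -/
def GUBC.sub (X : GUBC.{w, u} G) (S : SubMulAction G X.carrier) : GUBC.{w, u} G :=
  @GUBC.mk G _ (X.toGBornCoarse.sub S) (instUniformSpaceSubtype : UniformSpace S)
    (X.sub_exists_invariant_uniform S) (X.sub_compatible S)

/-- The inclusion of an invariant subset. -/
def GUBC.ι (X : GUBC.{w, u} G) (S : SubMulAction G X.carrier) : X.sub S ⟶ X :=
  @GUBC.Hom.mk G _ (X.sub S) X (X.toGBornCoarse.ι S)
    (uniformContinuous_subtype_val : UniformContinuous (Subtype.val : S → X.carrier))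

/-- The inclusion of invariant subsets `S ⊆ T`, both with the structures induced from `X`. -/
def GUBC.inclusion {X : GUBC.{w, u} G} {S T : SubMulAction G X.carrier} (h : S ≤ T) :
    X.sub S ⟶ X.sub T :=
  @GUBC.Hom.mk G _ (X.sub S) (X.sub T) (GBornCoarse.inclusion (X := X.toGBornCoarse) h)
    (UniformContinuous.subtype_mk (uniformContinuous_subtype_val (p := (· ∈ S))) (fun x => h x.2) :
      UniformContinuous (fun x : S => (⟨x.1, h x.2⟩ : T)))

/-- A pair `(A, B)` of invariant subsets is coarsely excisive if `A ∪ B = X` and for every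
coarse entourage `U` there is a coarse entourage `V` with `U[A] ∩ U[B] ⊆ V[A ∩ B]`. -/
def IsCoarselyExcisive (X : GBornCoarse.{w, u} G) (A B : SubMulAction G X.carrier) : Prop :=
  A ⊔ B = ⊤ ∧ ∀ U ∈ X.coarse.entourages, ∃ V ∈ X.coarse.entourages,
    thicken U (A : Set X.carrier) ∩ thicken U (B : Set X.carrier) ⊆
      thicken V ((A ⊓ B : SubMulAction G X.carrier) : Set X.carrier)

/-- A pair `(A, B)` of invariant subsets is uniformly excisive if `A ∪ B = X` and for every
uniform entourage `V` there is a uniform entourage `U` with `U[A] ∩ U[B] ⊆ V[A ∩ B]`. -/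
def IsUniformlyExcisive (X : GUBC.{w, u} G) (A B : SubMulAction G X.carrier) : Prop :=
  A ⊔ B = ⊤ ∧ ∀ V ∈ uniformity X.carrier, ∃ U ∈ uniformity X.carrier,
    thicken U (A : Set X.carrier) ∩ thicken U (B : Set X.carrier) ⊆
      thicken V ((A ⊓ B : SubMulAction G X.carrier) : Set X.carrier)

/-- The coarse structure of `ℝ ⊗ X`: the product of the metric coarse structure of `ℝ` and the
coarse structure of `X`. -/
def CoarseStructure.realProd {X : Type u} (C : CoarseStructure X) : CoarseStructure (ℝ × X) where
  entourages := {U | (∃ r : ℝ, ∀ p ∈ U, |p.1.1 - p.2.1| ≤ r) ∧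
    (Prod.map Prod.snd Prod.snd) '' U ∈ C.entourages}
  diag_mem := ⟨⟨0, fun p (hp : p.1 = p.2) => by simp [hp]⟩, C.subset_mem C.diag_mem (by
    rintro _ ⟨p, hp, rfl⟩
    exact congrArg Prod.snd hp)⟩
  subset_mem := fun ⟨⟨r, hr⟩, hV⟩ h =>
    ⟨⟨r, fun p hp => hr p (h hp)⟩, C.subset_mem hV (Set.image_mono h)⟩
  union_mem := fun ⟨⟨r, hr⟩, hU⟩ ⟨⟨s, hs⟩, hV⟩ =>
    ⟨⟨max r s, fun p hp => hp.elim (fun h => (hr p h).trans (le_max_left _ _))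
      (fun h => (hs p h).trans (le_max_right _ _))⟩, by
      rw [Set.image_union]
      exact C.union_mem hU hV⟩
  inv_mem := fun ⟨⟨r, hr⟩, hU⟩ =>
    ⟨⟨r, fun p hp => by rw [abs_sub_comm]; exact hr _ hp⟩, C.subset_mem (C.inv_mem hU) (by
      rintro _ ⟨p, hp, rfl⟩
      exact ⟨(p.2, p.1), hp, rfl⟩)⟩
  comp_mem := fun ⟨⟨r, hr⟩, hU⟩ ⟨⟨s, hs⟩, hV⟩ =>
    ⟨⟨r + s, fun p ⟨y, hy, hy'⟩ =>
      (abs_sub_le p.1.1 y.1 p.2.1).trans (add_le_add (hr _ hy) (hs _ hy'))⟩,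
      C.subset_mem (C.comp_mem hU hV) (by
        rintro _ ⟨p, ⟨y, hy, hy'⟩, rfl⟩
        exact ⟨y.2, ⟨_, hy, rfl⟩, ⟨_, hy', rfl⟩⟩)⟩

/-- The action of `G` on `ℝ × X` which is trivial on `ℝ`. -/
@[reducible]
def realAction (G : Type w) [Group G] (X : Type u) [MulAction G X] : MulAction G (ℝ × X) where
  smul g p := (p.1, g • p.2)
  one_smul p := Prod.ext rfl (one_smul G p.2)
  mul_smul g h p := Prod.ext rfl (mul_smul g h p.2)

/-- The `G`-uniform bornological coarse space `ℝ ⊗ X`, where `ℝ` has its metric structures and the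
trivial action. Bounded subsets are those contained in a product of bounded subsets. -/
def realTensor (X : GUBC.{w, u} G) : GUBC.{w, u} G where
  carrier := ℝ × X.carrier
  action := realAction G X.carrier
  bornology := inferInstance
  coarse := X.coarse.realProd
  exists_invariant := fun U ⟨⟨r, hr⟩, hU⟩ => by
    obtain ⟨V, hV, hUV, hi⟩ := X.exists_invariant _ hU
    refine ⟨{p | |p.1.1 - p.2.1| ≤ r ∧ (p.1.2, p.2.2) ∈ V}, ⟨⟨r, fun p hp => hp.1⟩,
      X.coarse.subset_mem hV ?_⟩, fun p hp => ⟨hr p hp, hUV ⟨p, hp, rfl⟩⟩, ?_⟩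
    · rintro _ ⟨p, hp, rfl⟩
      exact hp.2
    · intro g x y h
      exact ⟨h.1, hi g _ _ h.2⟩
  smul_bounded := fun g B hB => by
    rw [← Bornology.isBounded_image_fst_and_snd] at hB ⊢
    refine ⟨hB.1.subset ?_, (X.smul_bounded g _ hB.2).subset ?_⟩
    · rintro _ ⟨_, ⟨x, hx, rfl⟩, rfl⟩
      exact ⟨x, hx, rfl⟩
    · rintro _ ⟨_, ⟨x, hx, rfl⟩, rfl⟩
      exact ⟨x.2, ⟨x, hx, rfl⟩, rfl⟩
  thicken_bounded := fun U ⟨⟨r, hr⟩, hU⟩ B hB => by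
    rw [← Bornology.isBounded_image_fst_and_snd] at hB ⊢
    constructor
    · refine (hB.1.cthickening (δ := r)).subset ?_
      rintro _ ⟨x, ⟨a, ha, hxa⟩, rfl⟩
      exact Metric.mem_cthickening_of_dist_le x.1 a.1 r _ ⟨a, ha, rfl⟩ (hr _ hxa)
    · refine (X.thicken_bounded _ hU _ hB.2).subset ?_
      rintro _ ⟨x, ⟨a, ha, hxa⟩, rfl⟩
      exact ⟨a.2, ⟨a, ha, rfl⟩, ⟨_, hxa, rfl⟩⟩
  uniform := inferInstance
  exists_invariant_uniform := fun U hU => by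
    rw [uniformity_prod_eq_comap_prod, Filter.mem_comap] at hU
    obtain ⟨T, hT, hTU⟩ := hU
    obtain ⟨A, hA, V, hV, hAV⟩ := Filter.mem_prod_iff.1 hT
    obtain ⟨V', hV', hVV', hi⟩ := X.exists_invariant_uniform V hV
    refine ⟨(fun p : (ℝ × X.carrier) × (ℝ × X.carrier) =>
      ((p.1.1, p.2.1), (p.1.2, p.2.2))) ⁻¹' (A ×ˢ V'), ?_, ?_, ?_⟩
    · rw [uniformity_prod_eq_comap_prod]
      exact Filter.preimage_mem_comap (Filter.prod_mem_prod hA hV')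
    · intro p hp
      exact hTU (hAV ⟨hp.1, hVV' hp.2⟩)
    · intro g x y h
      exact ⟨h.1, hi g _ _ h.2⟩
  compatible := by
    obtain ⟨V, hV, hV'⟩ := X.compatible
    refine ⟨(fun p : (ℝ × X.carrier) × (ℝ × X.carrier) =>
      ((p.1.1, p.2.1), (p.1.2, p.2.2))) ⁻¹' ({q | dist q.1 q.2 < 1} ×ˢ V), ?_, ?_, ?_⟩
    · rw [uniformity_prod_eq_comap_prod]
      exact Filter.preimage_mem_comap (Filter.prod_mem_prod
        (Metric.dist_mem_uniformity one_pos) hV)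
    · exact ⟨1, fun p hp => le_of_lt hp.1⟩
    · refine X.coarse.subset_mem hV' ?_
      rintro _ ⟨p, hp, rfl⟩
      exact hp.2

/-- The `G`-uniform bornological coarse space `[0, ∞) ⊗ X`. -/
def halfTensor (X : GUBC.{w, u} G) : GUBC.{w, u} G :=
  (realTensor X).sub { carrier := {p : ℝ × X.carrier | 0 ≤ p.1}, smul_mem' := fun _ _ h => h }

/-- The hybrid coarse structure on `ℝ ⊗ X` for the big family `((-∞, n] × X)_n`: its entourages
are those entourages of `ℝ ⊗ X` which for every uniform entourage `V` are contained in `V` outside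
of some `((-∞, n] × X) × ((-∞, n] × X)`. -/
def hybrid (X : GUBC.{w, u} G) : CoarseStructure (ℝ × X.carrier) where
  entourages := {U | U ∈ X.coarse.realProd.entourages ∧
    ∀ V ∈ uniformity (ℝ × X.carrier), ∃ n : ℕ, ∀ p ∈ U, p ∈ V ∨ (p.1.1 ≤ n ∧ p.2.1 ≤ n)}
  diag_mem := ⟨X.coarse.realProd.diag_mem, fun V hV => ⟨0, fun p hp => Or.inl (by
    obtain ⟨a, b⟩ := p
    cases (show a = b from hp)
    exact refl_mem_uniformity hV)⟩⟩
  subset_mem := fun hV h => ⟨X.coarse.realProd.subset_mem hV.1 h, fun V hV' => by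
    obtain ⟨n, hn⟩ := hV.2 V hV'
    exact ⟨n, fun p hp => hn p (h hp)⟩⟩
  union_mem := fun hU hV => ⟨X.coarse.realProd.union_mem hU.1 hV.1, fun T hT => by
    obtain ⟨n, hn⟩ := hU.2 T hT
    obtain ⟨m, hm⟩ := hV.2 T hT
    have h1 : (n : ℝ) ≤ (max n m : ℕ) := by exact_mod_cast le_max_left n m
    have h2 : (m : ℝ) ≤ (max n m : ℕ) := by exact_mod_cast le_max_right n m
    refine ⟨max n m, fun p hp => hp.elim (fun h => (hn p h).imp_right ?_)
      (fun h => (hm p h).imp_right ?_)⟩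
    · exact fun h => ⟨h.1.trans h1, h.2.trans h1⟩
    · exact fun h => ⟨h.1.trans h2, h.2.trans h2⟩⟩
  inv_mem := fun hU => ⟨X.coarse.realProd.inv_mem hU.1, fun V hV => by
    obtain ⟨n, hn⟩ := hU.2 _ (symm_le_uniformity hV)
    exact ⟨n, fun p hp => (hn _ hp).imp (fun h => h) And.symm⟩⟩
  comp_mem := fun {U U'} hU hU' => ⟨X.coarse.realProd.comp_mem hU.1 hU'.1, fun V hV => by
    obtain ⟨T, hT, hTV⟩ := comp_mem_uniformity_sets hV
    obtain ⟨n, hn⟩ := hU.2 T hT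
    obtain ⟨m, hm⟩ := hU'.2 T hT
    obtain ⟨r, hr⟩ := hU.1.1
    obtain ⟨s, hs⟩ := hU'.1.1
    obtain ⟨k, hk⟩ := exists_nat_ge ((n : ℝ) + m + |r| + |s|)
    refine ⟨k, fun p ⟨y, hy, hy'⟩ => ?_⟩
    have h1 := abs_le.1 ((hr _ hy).trans (le_abs_self r))
    have h2 := abs_le.1 ((hs _ hy').trans (le_abs_self s))
    have hn0 : (0 : ℝ) ≤ n := n.cast_nonneg
    have hm0 : (0 : ℝ) ≤ m := m.cast_nonneg
    have hr0 := abs_nonneg r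
    have hs0 := abs_nonneg s
    simp only at h1 h2
    rcases hn _ hy with h | h
    · rcases hm _ hy' with h' | h'
      · exact Or.inl (hTV ⟨y, h, h'⟩)
      · right
        simp only at h'
        constructor <;> linarith [h'.1, h'.2, h1.1, h1.2, h2.1, h2.2]
    · right
      simp only at h
      constructor <;> linarith [h.1, h.2, h1.1, h1.2, h2.1, h2.2]⟩

/-- The `G`-bornological coarse space `𝒪(X)₋ = (ℝ ⊗ X)_h`. -/
def coneMinus (X : GUBC.{w, u} G) : GBornCoarse.{w, u} G where
  carrier := ℝ × X.carrier
  action := realAction G X.carrier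
  bornology := inferInstance
  coarse := hybrid X
  exists_invariant := fun U hU => by
    obtain ⟨V, hV, hUV, hi⟩ := (realTensor X).exists_invariant U hU.1
    refine ⟨{p | ∃ (g : G) (q : (ℝ × X.carrier) × (ℝ × X.carrier)), q ∈ U ∧
      p = ((q.1.1, g • q.1.2), (q.2.1, g • q.2.2))}, ⟨?_, ?_⟩, ?_, ?_⟩
    · refine X.coarse.realProd.subset_mem hV ?_
      rintro _ ⟨g, q, hq, rfl⟩
      exact hi g q.1 q.2 (hUV hq)
    · intro T hT
      obtain ⟨T', hT', hTT', hi'⟩ := (realTensor X).exists_invariant_uniform T hT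
      obtain ⟨n, hn⟩ := hU.2 T' hT'
      refine ⟨n, ?_⟩
      rintro _ ⟨g, q, hq, rfl⟩
      exact (hn q hq).imp_left fun h => hTT' (hi' g q.1 q.2 h)
    · intro p hp
      exact ⟨1, p, hp, by simp⟩
    · rintro h _ _ ⟨g, q, hq, hxy⟩
      obtain ⟨rfl, rfl⟩ := Prod.mk.inj hxy
      exact ⟨h * g, q, hq, Prod.ext (Prod.ext rfl (mul_smul h g q.1.2).symm)
        (Prod.ext rfl (mul_smul h g q.2.2).symm)⟩
  smul_bounded := (realTensor X).smul_bounded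
  thicken_bounded := fun U hU => (realTensor X).thicken_bounded U hU.1

/-- The invariant subset `I × S` of `𝒪(X)₋`. -/
def slab (X : GUBC.{w, u} G) (I : Set ℝ) (S : SubMulAction G X.carrier) :
    SubMulAction G (coneMinus X).carrier where
  carrier := {p : ℝ × X.carrier | p.1 ∈ I ∧ p.2 ∈ S}
  smul_mem' := fun g _ h => ⟨h.1, S.smul_mem g h.2⟩

/-- The cone `𝒪(X)`: the subset `[0, ∞) × X` of `𝒪(X)₋`. -/
def cone (X : GUBC.{w, u} G) : GBornCoarse.{w, u} G :=
  (coneMinus X).sub (slab X (Set.Ici 0) ⊤)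

/-- The functoriality of `X ↦ 𝒪(X)₋`. -/
def coneMinusMap {X Y : GUBC.{w, u} G} (f : X ⟶ Y) : coneMinus X ⟶ coneMinus Y where
  toFun := fun p : ℝ × X.carrier => ((p.1, f.toFun p.2) : ℝ × Y.carrier)
  equivariant := fun g (p : ℝ × X.carrier) => Prod.ext rfl (f.equivariant g p.2)
  controlled := fun U hU => by
    refine ⟨⟨?_, ?_⟩, ?_⟩
    · obtain ⟨r, hr⟩ := hU.1.1
      refine ⟨r, ?_⟩
      rintro _ ⟨p, hp, rfl⟩
      exact hr p hp
    · refine Y.coarse.subset_mem (f.controlled _ hU.1.2) ?_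
      rintro _ ⟨_, ⟨p, hp, rfl⟩, rfl⟩
      exact ⟨_, ⟨p, hp, rfl⟩, rfl⟩
    · intro V hV
      have hc : UniformContinuous
          (fun p : ℝ × X.carrier => ((p.1, f.toFun p.2) : ℝ × Y.carrier)) :=
        uniformContinuous_fst.prodMk (f.uniformContinuous.comp uniformContinuous_snd)
      obtain ⟨n, hn⟩ := hU.2 _ (hc hV)
      refine ⟨n, ?_⟩
      rintro _ ⟨p, hp, rfl⟩
      exact hn p hp
  proper := fun B hB => by
    have hB' := Bornology.isBounded_image_fst_and_snd.2 hB
    refine Bornology.isBounded_image_fst_and_snd.1 ⟨hB'.1.subset ?_, (f.proper _ hB'.2).subset ?_⟩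
    · rintro _ ⟨p, hp, rfl⟩
      exact ⟨_, hp, rfl⟩
    · rintro _ ⟨p, hp, rfl⟩
      exact ⟨_, hp, rfl⟩

/-- The morphism `𝒪(f) : 𝒪(X) → 𝒪(Y)`. -/
def coneMap {X Y : GUBC.{w, u} G} (f : X ⟶ Y) : cone X ⟶ cone Y :=
  GBornCoarse.restrict (coneMinusMap f) _ _ (fun _ h => ⟨h.1, trivial⟩)

/-- The embedding `X ≅ {0} × X → 𝒪(X)₋`. -/
def coneMinusZero (X : GUBC.{w, u} G) : X.toGBornCoarse ⟶ coneMinus X where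
  toFun := fun x => ((0, x) : ℝ × X.carrier)
  equivariant := fun _ _ => rfl
  controlled := fun U hU => by
    refine ⟨⟨⟨0, ?_⟩, X.coarse.subset_mem hU ?_⟩, fun V _ => ⟨0, ?_⟩⟩
    · rintro _ ⟨p, hp, rfl⟩
      exact (by simp : |(0 : ℝ) - 0| ≤ 0)
    · rintro _ ⟨_, ⟨p, hp, rfl⟩, rfl⟩
      exact hp
    · rintro _ ⟨p, hp, rfl⟩
      exact Or.inr (by simp : (0 : ℝ) ≤ (0 : ℕ) ∧ (0 : ℝ) ≤ (0 : ℕ))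
  proper := fun B hB => by
    refine (Bornology.isBounded_image_fst_and_snd.2 hB).2.subset ?_
    intro x hx
    exact ⟨_, hx, rfl⟩

/-- The embedding `X ≅ {0} × X → 𝒪(X)`. -/
def coneZero (X : GUBC.{w, u} G) : X.toGBornCoarse ⟶ cone X :=
  GBornCoarse.lift (coneMinusZero X) _ (fun _ => ⟨Set.self_mem_Ici, trivial⟩)

/-- For `S ⊆ X` and `{0} × S ⊆ T ⊆ ℝ × X`, the embedding `S → T`, `s ↦ (0, s)`, where `T` has the
structures induced from `𝒪(X)₋`. -/
def subZero (X : GUBC.{w, u} G) (S : SubMulAction G X.carrier)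
    (T : SubMulAction G (coneMinus X).carrier) (h : slab X {0} S ≤ T) :
    (X.sub S).toGBornCoarse ⟶ (coneMinus X).sub T :=
  GBornCoarse.restrict (coneMinusZero X) S T (fun _ hx => h ⟨rfl, hx⟩)

/-- For `S ⊆ X` and `[0, ∞) × S ⊆ T ⊆ ℝ × X`, the embedding `𝒪(S) → T`, where `T` has the
structures induced from `𝒪(X)₋`. -/
def subCone (X : GUBC.{w, u} G) (S : SubMulAction G X.carrier)
    (T : SubMulAction G (coneMinus X).carrier) (h : slab X (Set.Ici 0) S ≤ T) :
    cone (X.sub S) ⟶ (coneMinus X).sub T :=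
  GBornCoarse.restrict (coneMinusMap (X.ι S)) _ T (fun x hx => h ⟨hx.1, x.2.2⟩)

end UniformBornCoarse

/-! ## Spectra -/

/-- The map induced by a continuous map on sets of path components. -/
def pi0Map {X Y : Type v} [TopologicalSpace X] [TopologicalSpace Y] (f : C(X, Y)) :
    ZerothHomotopy X → ZerothHomotopy Y :=
  Quotient.map f (fun _ _ h => h.map f.continuous)

/-- The map induced by a continuous map on homotopy groups. -/
def homotopyGroupMap {X Y : Type v} [TopologicalSpace X] [TopologicalSpace Y] (f : C(X, Y))
    (m : ℕ) (x : X) : HomotopyGroup (Fin m) X x → HomotopyGroup (Fin m) Y (f x) :=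
  Quotient.map (fun p => ⟨f.comp p.1, fun y hy => congrArg f (p.2 y hy)⟩)
    (fun _ _ h => ContinuousMap.HomotopicRel.comp_continuousMap h f)

/-- Weak homotopy equivalences between (nonempty) spaces. -/
def IsWeakEquiv {X Y : Type v} [TopologicalSpace X] [TopologicalSpace Y] (f : C(X, Y)) : Prop :=
  ∀ (m : ℕ) (x : X), Function.Bijective (homotopyGroupMap f m x)

/-- Spectra, modelled by `Ω`-spectra of pointed topological spaces indexed by the integers. The
indexing is homological: `space n` is the `n`-fold loop space of `space 0` for `n ≥ 0`, and the
`(-n)`-fold delooping for `n ≤ 0`. -/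
structure Spectrum where
  space : ℤ → Type v
  [top : ∀ n, TopologicalSpace (space n)]
  pt : ∀ n, space n
  str : ∀ n, C(space (n + 1), Path (pt n) (pt n))
  str_pt : ∀ n, str n (pt (n + 1)) = Path.refl (pt n)
  str_weakEquiv : ∀ n, IsWeakEquiv (str n)

attribute [instance] Spectrum.top

/-- Morphisms of spectra: pointed continuous maps compatible with the structure maps. -/
@[ext]
structure Spectrum.Hom (E F : Spectrum.{v}) where
  map : ∀ n, C(E.space n, F.space n)
  map_pt : ∀ n, map n (E.pt n) = F.pt n
  map_str : ∀ n (x : E.space (n + 1)) (t : unitInterval),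
    F.str n (map (n + 1) x) t = map n (E.str n x t)

instance Spectrum.category : Category Spectrum.{v} where
  Hom E F := Spectrum.Hom E F
  id E :=
    { map := fun _ => ContinuousMap.id _
      map_pt := fun _ => rfl
      map_str := fun _ _ _ => rfl }
  comp f g :=
    { map := fun n => (g.map n).comp (f.map n)
      map_pt := fun n => by simp [f.map_pt, g.map_pt]
      map_str := fun n x t => by simp [f.map_str, g.map_str] }

/-- (The underlying set of) the `n`-th stable homotopy group of a spectrum, `n ∈ ℤ`. -/
def Spectrum.Pi (E : Spectrum.{v}) (n : ℤ) : Type v :=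
  ZerothHomotopy (E.space n)

/-- The map induced on stable homotopy groups. -/
def Spectrum.piMap {E F : Spectrum.{v}} (f : E ⟶ F) (n : ℤ) : E.Pi n → F.Pi n :=
  pi0Map (f.map n)

/-- The `n`-th space of the homotopy fibre of a morphism of spectra: pairs of a point `a` of
`E_n` and a path from the base point of `F_n` to `f a`. -/
def Spectrum.Fib {E F : Spectrum.{v}} (f : E ⟶ F) (n : ℤ) : Type v :=
  {p : E.space n × C(unitInterval, F.space n) // p.2 0 = F.pt n ∧ p.2 1 = f.map n p.1}

instance {E F : Spectrum.{v}} (f : E ⟶ F) (n : ℤ) : TopologicalSpace (Spectrum.Fib f n) :=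
  inferInstanceAs (TopologicalSpace {p : E.space n × C(unitInterval, F.space n) //
    p.2 0 = F.pt n ∧ p.2 1 = f.map n p.1})

/-- (The underlying set of) `π_{n+1}(Cofib f)`. As the cofibre of a morphism of spectra is the
suspension of its fibre, this is `π_n` of the fibre. -/
def Spectrum.PiCofib {E F : Spectrum.{v}} (f : E ⟶ F) (n : ℤ) : Type v :=
  ZerothHomotopy (Spectrum.Fib f n)

/-- The map `π_{n+1}(F) → π_{n+1}(Cofib f)` for `f : E → F`. It sends (the loop of) a point of
`F_{n+1}` to the point of the fibre given by that loop. -/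
def Spectrum.toCofib {E F : Spectrum.{v}} (f : E ⟶ F) (n : ℤ) :
    F.Pi (n + 1) → Spectrum.PiCofib f n :=
  pi0Map (X := F.space (n + 1)) (Y := Spectrum.Fib f n)
    { toFun := fun x => ⟨(E.pt n, (F.str n x : C(unitInterval, F.space n))),
        (F.str n x).source, (F.str n x).target.trans (f.map_pt n).symm⟩
      continuous_toFun := by
        refine Continuous.subtype_mk (continuous_const.prodMk ?_) _
        exact continuous_induced_dom.comp (F.str n).continuous }

/-- The boundary map `π_{n+1}(Cofib f) → π_n(E)` for `f : E → F`. -/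
def Spectrum.cofibBoundary {E F : Spectrum.{v}} (f : E ⟶ F) (n : ℤ) :
    Spectrum.PiCofib f n → E.Pi n :=
  pi0Map (X := Spectrum.Fib f n) (Y := E.space n)
    { toFun := fun p => p.1.1
      continuous_toFun := continuous_fst.comp continuous_subtype_val }

/-- The map `π_{n+1}(Cofib f) → π_{n+1}(Cofib f')` induced by a commutative square. -/
def Spectrum.cofibMap {E F E' F' : Spectrum.{v}} {f : E ⟶ F} {f' : E' ⟶ F'} {a : E ⟶ E'}
    {b : F ⟶ F'} (h : a ≫ f' = f ≫ b) (n : ℤ) :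
    Spectrum.PiCofib f n → Spectrum.PiCofib f' n :=
  pi0Map (X := Spectrum.Fib f n) (Y := Spectrum.Fib f' n)
    { toFun := fun p => ⟨(a.map n p.1.1, (b.map n).comp p.1.2), by
        refine ⟨(congrArg (b.map n) p.2.1).trans (b.map_pt n), ?_⟩
        refine (congrArg (b.map n) p.2.2).trans ?_
        have := congrArg (fun k : E ⟶ F' => Spectrum.Hom.map k n p.1.1) h
        exact this.symm⟩
      continuous_toFun := by
        refine Continuous.subtype_mk (Continuous.prodMk ?_ ?_) _
        · exact (a.map n).continuous.comp (continuous_fst.comp continuous_subtype_val)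
        · exact (ContinuousMap.continuous_postcomp (b.map n)).comp
            (continuous_snd.comp continuous_subtype_val) }

/-! ## Equivariant coarse homology theories -/

section Homology

variable {G : Type w} [Group G]

/-- `E_n(X) = π_n(E(X))`. -/
def HPi (E : GBornCoarse.{w, u} G ⥤ Spectrum.{v}) (n : ℤ) (X : GBornCoarse.{w, u} G) : Type v :=
  (E.obj X).Pi n

/-- The map `E_n(f) : E_n(X) → E_n(Y)`. -/
def hMap (E : GBornCoarse.{w, u} G ⥤ Spectrum.{v}) (n : ℤ) {X Y : GBornCoarse.{w, u} G}
    (f : X ⟶ Y) : HPi E n X → HPi E n Y :=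
  Spectrum.piMap (E.map f) n

/-- `π_{n+1}` of the cofibre of `E(f) : E(A) → E(X)`. -/
def HRel (E : GBornCoarse.{w, u} G ⥤ Spectrum.{v}) (n : ℤ) {A X : GBornCoarse.{w, u} G}
    (f : A ⟶ X) : Type v :=
  Spectrum.PiCofib (E.map f) n

/-- The canonical map `E_{n+1}(X) → π_{n+1}(Cofib(E(A) → E(X)))`. -/
def toRel (E : GBornCoarse.{w, u} G ⥤ Spectrum.{v}) (n : ℤ) {A X : GBornCoarse.{w, u} G}
    (f : A ⟶ X) : HPi E (n + 1) X → HRel E n f :=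
  Spectrum.toCofib (E.map f) n

/-- The boundary map `π_{n+1}(Cofib(E(A) → E(X))) → E_n(A)`. -/
def relBoundary (E : GBornCoarse.{w, u} G ⥤ Spectrum.{v}) (n : ℤ) {A X : GBornCoarse.{w, u} G}
    (f : A ⟶ X) : HRel E n f → HPi E n A :=
  Spectrum.cofibBoundary (E.map f) n

/-- The map between the groups `HRel` induced by a commutative square. -/
def relMap (E : GBornCoarse.{w, u} G ⥤ Spectrum.{v}) (n : ℤ) {A X A' X' : GBornCoarse.{w, u} G}
    {f : A ⟶ X} {f' : A' ⟶ X'} {a : A ⟶ A'} {b : X ⟶ X'} (h : a ≫ f' = f ≫ b) :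
    HRel E n f → HRel E n f' :=
  Spectrum.cofibMap (a := E.map a) (b := E.map b)
    (by rw [← E.map_comp, ← E.map_comp, h]) n

/-- Excision for an equivariant complementary pair `(Z, 𝒴)`: the square with corners `E(Z ∩ 𝒴)`,
`E(Z)`, `E(𝒴)`, `E(X)` is cocartesian, where `E(𝒴) = colim_{Y ∈ 𝒴} E(Y)`. Equivalently, the map of
cofibres `colim_Y E(Z)/E(Z ∩ Y) → colim_Y E(X)/E(Y)` induces bijections on homotopy groups.
Homotopy groups commute with filtered colimits, and bijectivity of the map between the
filtered colimits of homotopy groups is spelled out on elements. -/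
def IsExcisiveFor (E : GBornCoarse.{w, u} G ⥤ Spectrum.{v}) (X : GBornCoarse.{w, u} G)
    (Z : SubMulAction G X.carrier) (𝒴 : BigFamily X) : Prop :=
  ∀ n : ℤ,
    (∀ Y ∈ 𝒴.members, ∀ x : HRel E n (X.ι Y), ∃ Y' ∈ 𝒴.members, ∃ h : Y ≤ Y',
      ∃ z : HRel E n (GBornCoarse.inclusion (inf_le_left : Z ⊓ Y' ≤ Z)),
        relMap E n (f := GBornCoarse.inclusion (inf_le_left : Z ⊓ Y' ≤ Z)) (f' := X.ι Y')
          (a := GBornCoarse.inclusion (inf_le_right : Z ⊓ Y' ≤ Y')) (b := X.ι Z) rfl z =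
        relMap E n (f := X.ι Y) (f' := X.ι Y')
          (a := GBornCoarse.inclusion h) (b := 𝟙 X) rfl x) ∧
    (∀ Y ∈ 𝒴.members,
      ∀ z z' : HRel E n (GBornCoarse.inclusion (inf_le_left : Z ⊓ Y ≤ Z)),
        relMap E n (f := GBornCoarse.inclusion (inf_le_left : Z ⊓ Y ≤ Z)) (f' := X.ι Y)
          (a := GBornCoarse.inclusion (inf_le_right : Z ⊓ Y ≤ Y)) (b := X.ι Z) rfl z =
        relMap E n (f := GBornCoarse.inclusion (inf_le_left : Z ⊓ Y ≤ Z)) (f' := X.ι Y)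
          (a := GBornCoarse.inclusion (inf_le_right : Z ⊓ Y ≤ Y)) (b := X.ι Z) rfl z' →
        ∃ Y' ∈ 𝒴.members, ∃ h : Y ≤ Y',
          relMap E n (f := GBornCoarse.inclusion (inf_le_left : Z ⊓ Y ≤ Z))
            (f' := GBornCoarse.inclusion (inf_le_left : Z ⊓ Y' ≤ Z))
            (a := GBornCoarse.inclusion (inf_le_inf_left Z h)) (b := 𝟙 (X.sub Z)) rfl z =
          relMap E n (f := GBornCoarse.inclusion (inf_le_left : Z ⊓ Y ≤ Z))
            (f' := GBornCoarse.inclusion (inf_le_left : Z ⊓ Y' ≤ Z))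
            (a := GBornCoarse.inclusion (inf_le_inf_left Z h)) (b := 𝟙 (X.sub Z)) rfl z')

/-- Spectrum-valued equivariant coarse homology theories: functors from `G`-bornological coarse
spaces to spectra which are coarsely invariant, excisive, vanish on flasques and are u-continuous.
For the last axiom, bijectivity of `colim_U E_n(X_U) → E_n(X)` is spelled out on elements. (A map
of `Ω`-spectra is an equivalence if and only if all its components are weak equivalences.) -/
structure CoarseHomologyTheory (G : Type w) [Group G] where
  functor : GBornCoarse.{w, u} G ⥤ Spectrum.{v}
  coarse_invariance : ∀ {X Y : GBornCoarse.{w, u} G} (f : X ⟶ Y), IsCoarseEquivalence f →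
    ∀ n : ℤ, IsWeakEquiv ((functor.map f).map n)
  empty : ∀ X : GBornCoarse.{w, u} G, IsEmpty X.carrier → ∀ n : ℤ, Subsingleton (HPi functor n X)
  excision : ∀ (X : GBornCoarse.{w, u} G) (Z : SubMulAction G X.carrier) (𝒴 : BigFamily X),
    (∃ Y ∈ 𝒴.members, Z ⊔ Y = ⊤) → IsExcisiveFor functor X Z 𝒴
  flasque : ∀ X : GBornCoarse.{w, u} G, IsFlasque X → ∀ n : ℤ, Subsingleton (HPi functor n X)
  u_continuity_surj : ∀ (X : GBornCoarse.{w, u} G) (n : ℤ) (x : HPi functor n X),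
    ∃ U, ∃ (hU : U ∈ X.coarse.entourages) (hi : IsInvariant G U),
      ∃ y : HPi functor n (X.atEntourage U hU hi),
        hMap functor n (X.fromEntourage U hU hi) y = x
  u_continuity_inj : ∀ (X : GBornCoarse.{w, u} G) (n : ℤ) (U : Set (X.carrier × X.carrier))
    (hU : U ∈ X.coarse.entourages) (hi : IsInvariant G U)
    (y y' : HPi functor n (X.atEntourage U hU hi)),
    hMap functor n (X.fromEntourage U hU hi) y = hMap functor n (X.fromEntourage U hU hi) y' →
    ∃ V, ∃ (hV : V ∈ X.coarse.entourages) (hj : IsInvariant G V) (h : U ⊆ V),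
      hMap functor n (X.mapEntourage hU hi hV hj h) y =
        hMap functor n (X.mapEntourage hU hi hV hj h) y'

/-- `E` sends the commutative square

  `P --j--> B`
  `|i       |b`
  `A --a--> X`

to a cocartesian square of spectra, i.e. `E(B)/E(P) → E(X)/E(A)` is an equivalence. -/
def IsCocartesian (E : GBornCoarse.{w, u} G ⥤ Spectrum.{v}) {P A B X : GBornCoarse.{w, u} G}
    {i : P ⟶ A} {j : P ⟶ B} {a : A ⟶ X} {b : B ⟶ X} (h : i ≫ a = j ≫ b) : Prop :=
  ∀ n : ℤ, Function.Bijective (relMap E n h)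

/-- The Mayer-Vietoris boundary map `E_{n+1}(X) → E_n(P)` of a square which `E` sends to a
cocartesian square: the composition
`E(X) → E(X)/E(A) ≃ E(B)/E(P) → Σ E(P)`. -/
def mvBoundary (E : GBornCoarse.{w, u} G ⥤ Spectrum.{v}) {P A B X : GBornCoarse.{w, u} G}
    {i : P ⟶ A} {j : P ⟶ B} {a : A ⟶ X} {b : B ⟶ X} (h : i ≫ a = j ≫ b)
    (hE : IsCocartesian E h) (n : ℤ) : HPi E (n + 1) X → HPi E n P :=
  fun x => relBoundary E n j ((Equiv.ofBijective _ (hE n)).symm (toRel E n a x))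

end Homology

/-! ## Abstract boundary value problems -/

section BoundaryValueProblems

variable {G : Type w} [Group G]

/-- Symbols of degree `n` on `X`: the classes in `E_{n+1}(𝒪^∞(X))`, where `𝒪^∞(X)` is the
cofibre of `X → 𝒪(X)`. -/
def Symbol (E : GBornCoarse.{w, u} G ⥤ Spectrum.{v}) (X : GUBC.{w, u} G) (n : ℤ) : Type v :=
  HRel E n (coneZero X)

/-- `(-∞, 0] × X`. -/
def lowerHalf (X : GUBC.{w, u} G) : SubMulAction G (coneMinus X).carrier :=
  slab X (Set.Iic 0) ⊤

/-- The square with corners `X`, `(-∞, 0] × X`, `𝒪(X)` and `𝒪(X)₋`. -/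
theorem coneSquare (X : GUBC.{w, u} G) :
    GBornCoarse.lift (coneMinusZero X) (lowerHalf X) (fun _ => ⟨Set.self_mem_Iic, trivial⟩) ≫
      (coneMinus X).ι (lowerHalf X) = coneZero X ≫ (coneMinus X).ι (slab X (Set.Ici 0) ⊤) :=
  rfl

/-- That `E(𝒪(X)₋) → E(𝒪(X)₋)/E((-∞, 0] × X)` is an equivalence. -/
def LowerHalfVanishes (E : GBornCoarse.{w, u} G ⥤ Spectrum.{v}) (X : GUBC.{w, u} G) : Prop :=
  ∀ n : ℤ, Function.Bijective (toRel E n ((coneMinus X).ι (lowerHalf X)))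

/-- The map `c : E_{n+1}(𝒪^∞(X)) → E_{n+1}(𝒪(X)₋)` induced by `𝒪(X) → 𝒪(X)₋` and the universal
property of the cofibre `𝒪^∞(X)`, i.e. the composition
`E(𝒪(X))/E(X) → E(𝒪(X)₋)/E((-∞, 0] × X) ≃ E(𝒪(X)₋)`. -/
def coneComparison (E : GBornCoarse.{w, u} G ⥤ Spectrum.{v}) (X : GUBC.{w, u} G)
    (h : LowerHalfVanishes E X) (n : ℤ) : Symbol E X n → HPi E (n + 1) (coneMinus X) :=
  fun σ => (Equiv.ofBijective _ (h n)).symm (relMap E n (coneSquare X) σ)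

/-- `Y = (-∞, 0] × W ∪ [0, ∞) × X`. -/
def bvpY (X : GUBC.{w, u} G) (W : SubMulAction G X.carrier) :
    SubMulAction G (coneMinus X).carrier :=
  slab X (Set.Iic 0) W ⊔ slab X (Set.Ici 0) ⊤

/-- The map `i : E_{n+1}(Y) → E_{n+1}(𝒪^∞(X))` induced by the inclusion of `Y` into `𝒪(X)₋` and
the inverse of `c`. -/
def mapI (E : GBornCoarse.{w, u} G ⥤ Spectrum.{v}) (X : GUBC.{w, u} G)
    (W : SubMulAction G X.carrier) (h : LowerHalfVanishes E X)
    (hc : ∀ n : ℤ, Function.Bijective (coneComparison E X h n)) (n : ℤ) :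
    HPi E (n + 1) ((coneMinus X).sub (bvpY X W)) → Symbol E X n :=
  fun b => (Equiv.ofBijective _ (hc n)).symm (hMap E (n + 1) ((coneMinus X).ι (bvpY X W)) b)

/-- A boundary condition for the symbol `σ` is a class `b` in `E_{n+1}(Y)` with `i(b) = σ`. -/
def IsBoundaryCondition (E : GBornCoarse.{w, u} G ⥤ Spectrum.{v}) (X : GUBC.{w, u} G)
    (W : SubMulAction G X.carrier) (h : LowerHalfVanishes E X)
    (hc : ∀ n : ℤ, Function.Bijective (coneComparison E X h n)) {n : ℤ} (σ : Symbol E X n)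
    (b : HPi E (n + 1) ((coneMinus X).sub (bvpY X W))) : Prop :=
  mapI E X W h hc n b = σ

theorem slab_le_slab (X : GUBC.{w, u} G) {I J : Set ℝ} {S T : SubMulAction G X.carrier}
    (hI : I ⊆ J) (hS : S ≤ T) : slab X I S ≤ slab X J T :=
  fun _ h => ⟨hI h.1, hS h.2⟩

theorem univ_slab_le_bvpY (X : GUBC.{w, u} G) (W : SubMulAction G X.carrier) :
    slab X Set.univ W ≤ bvpY X W :=
  fun p h => (le_total p.1 (0 : ℝ)).imp (fun h' => ⟨h', h.2⟩) (fun h' => ⟨h', trivial⟩)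

/-- The square with corners `W`, `Y₋ = (-∞, 0] × W`, `Y₊ = [0, ∞) × X` and `Y`. -/
theorem indexSquare (X : GUBC.{w, u} G) (W : SubMulAction G X.carrier) :
    subZero X W (slab X (Set.Iic 0) W)
        (slab_le_slab X (by simp) le_rfl) ≫
      GBornCoarse.inclusion (le_sup_left : slab X (Set.Iic 0) W ≤ bvpY X W) =
    subZero X W (slab X (Set.Ici 0) ⊤) (slab_le_slab X (by simp) le_top) ≫
      GBornCoarse.inclusion (le_sup_right : slab X (Set.Ici 0) ⊤ ≤ bvpY X W) :=
  rfl

/-- The square with corners `𝒪(M)`, `ℝ × W`, `[0, ∞) × M_∞` and `Y`, where `M = M_∞ ∩ W`. -/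
theorem rhoSquare (X : GUBC.{w, u} G) (Minf W : SubMulAction G X.carrier) :
    subCone X (Minf ⊓ W) (slab X Set.univ W) (slab_le_slab X (Set.subset_univ _) inf_le_right) ≫
      GBornCoarse.inclusion (univ_slab_le_bvpY X W) =
    subCone X (Minf ⊓ W) (slab X (Set.Ici 0) Minf) (slab_le_slab X subset_rfl inf_le_left) ≫
      GBornCoarse.inclusion
        ((slab_le_slab X subset_rfl le_top).trans le_sup_right :
          slab X (Set.Ici 0) Minf ≤ bvpY X W) :=
  rfl

/-- The index `Ind(σ, on(W)) = ∂ b` in `E_n(W)` of a symbol subject to the boundary condition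
`b`. Here `∂` is the Mayer-Vietoris boundary map of the decomposition `(Y₋, Y₊)` of `Y`. -/
def bvpIndex (E : GBornCoarse.{w, u} G ⥤ Spectrum.{v}) (X : GUBC.{w, u} G)
    (W : SubMulAction G X.carrier) (h : IsCocartesian E (indexSquare X W)) {n : ℤ}
    (b : HPi E (n + 1) ((coneMinus X).sub (bvpY X W))) : HPi E n (X.sub W).toGBornCoarse :=
  mvBoundary E (indexSquare X W) h n b

/-- The rho-invariant `ρ(M) = ∂' b` in `E_n(𝒪(M))` of the boundary condition `b`. Here `∂'` is the
Mayer-Vietoris boundary map of the decomposition `(ℝ × W, [0, ∞) × M_∞)` of `Y`. -/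
def rhoInvariant (E : GBornCoarse.{w, u} G ⥤ Spectrum.{v}) (X : GUBC.{w, u} G)
    (Minf W : SubMulAction G X.carrier) (h : IsCocartesian E (rhoSquare X Minf W)) {n : ℤ}
    (b : HPi E (n + 1) ((coneMinus X).sub (bvpY X W))) :
    HPi E n (cone (X.sub (Minf ⊓ W))) :=
  mvBoundary E (rhoSquare X Minf W) h n b

end BoundaryValueProblems

end

end CoarseAPS

/-! Both sides of the formula equal a third Mayer-Vietoris boundary. The space `Y` also decomposes
as `(ℝ × W, [0, ∞) × W_∞)`, with intersection `𝒪(W)`; let `∂''` be its boundary map. Enlarging `[0,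
∞) × M_∞` to `[0, ∞) × W_∞` maps the decomposition defining `∂'` to this one and induces `φ` on
intersections. Enlarging `(-∞, 0] × W` to `ℝ × W` maps the decomposition defining `∂` to it and
induces `ψ`. Both morphisms of squares are the identity on `Y`, so naturality of the boundary
(`hMap_mvBoundary`) gives `φ ∘ ∂' = ∂'' = ψ ∘ ∂`.

The work lies in showing that the three squares are cocartesian. Excision is an axiom for big
families only, so neighbourhoods of the first piece `A` must be replaced by `A` itself.
`isCocartesian_of_retraction` does this with an equivariant map `ρ` into `A` which preserves the
second piece and is close to the identity on every coarse thickening of `A`. Such maps come from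
`exists_retraction`: collapsing `M_∞ ≅ [0, ∞) ⊗ M` to `M` gives `r : W_∞ → W`. Excisiveness of
`(M_∞, W)` says that points of `M_∞` near `W` are near `M`, so `r` moves them little, both coarsely
and uniformly. On the cone, `(t, x) ↦ (min t 0, r x)` serves `∂`, and `(t, x) ↦ (t, r x)` serves
`∂'` and `∂''`; the uniform estimate is what the hybrid structure demands of the latter.

That `c` is an equivalence follows from the same criterion with `r = id`, together with flasqueness
of `(-∞, 0] × X`. On the side of spectra, one needs that cofibres are invariant under equivalences
of the source and that a source with vanishing homotopy does not change the target. Both come from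
describing `π₀` of the homotopy fibre by homotopy classes of paths. -/

namespace CoarseAPS

noncomputable section

/-! ## Homotopy groups and homotopy fibres -/

theorem zerothHomotopy_eq {X : Type v} [TopologicalSpace X] {x y : X} :
    (Quotient.mk _ x : ZerothHomotopy X) = Quotient.mk _ y ↔ Joined x y :=
  Quotient.eq (r := pathSetoid X)

/-- The cube of dimension `0` is a point with empty boundary, so a homotopy relative to the boundary
is just a path. This and its converse translate degree `0` of `IsWeakEquiv` into path components. -/
theorem genLoop_homotopic_of_joined {X : Type v} [TopologicalSpace X] {x₀ x y : X}
    (h : Joined x y) :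
    GenLoop.Homotopic ((genLoopHomeoOfIsEmpty (Fin 0) x₀).symm x)
      ((genLoopHomeoOfIsEmpty (Fin 0) x₀).symm y) := by
  obtain ⟨γ⟩ := h
  refine ⟨⟨⟨γ.toContinuousMap.comp ContinuousMap.fst, fun _ => γ.source, fun _ => γ.target⟩, ?_⟩⟩
  intro t y hy
  obtain ⟨i, -⟩ := hy
  exact i.elim0

theorem joined_of_genLoop_homotopic {X : Type v} [TopologicalSpace X] {x₀ : X}
    {p q : GenLoop (Fin 0) X x₀} (h : GenLoop.Homotopic p q) :
    Joined (p finZeroElim) (q finZeroElim) := by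
  obtain ⟨H⟩ := h
  exact ⟨H.evalAt finZeroElim⟩

theorem IsWeakEquiv.pi0_injective {X Y : Type v} [TopologicalSpace X] [TopologicalSpace Y]
    {f : C(X, Y)} (hf : IsWeakEquiv f) {x y : X} (h : Joined (f x) (f y)) : Joined x y := by
  have := @(hf 0 x).1 (Quotient.mk _ ((genLoopHomeoOfIsEmpty (Fin 0) x).symm x))
    (Quotient.mk _ ((genLoopHomeoOfIsEmpty (Fin 0) x).symm y))
    (Quotient.sound (genLoop_homotopic_of_joined h))
  exact joined_of_genLoop_homotopic (Quotient.exact this)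

/-- The point `x₀` is needed because `IsWeakEquiv` is a condition at base points and is vacuous for
empty `X`. -/
theorem IsWeakEquiv.pi0_surjective {X Y : Type v} [TopologicalSpace X] [TopologicalSpace Y]
    {f : C(X, Y)} (hf : IsWeakEquiv f) (x₀ : X) (y : Y) : ∃ x, Joined (f x) y := by
  obtain ⟨p, hp⟩ := (hf 0 x₀).2 (Quotient.mk _ ((genLoopHomeoOfIsEmpty (Fin 0) (f x₀)).symm y))
  induction p using Quotient.inductionOn with
  | h p => exact ⟨p finZeroElim, joined_of_genLoop_homotopic (Quotient.exact hp)⟩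

theorem IsWeakEquiv.exists_loop {X Y : Type v} [TopologicalSpace X] [TopologicalSpace Y]
    {f : C(X, Y)} (hf : IsWeakEquiv f) (x : X) (l : Path (f x) (f x)) :
    ∃ l' : Path x x, (l'.map f.continuous).Homotopic l := by
  obtain ⟨p, hp⟩ := (hf 1 x).2 (Quotient.mk _ ((genLoopEquivOfUnique (Fin 1)).symm l))
  induction p using Quotient.inductionOn with
  | h p =>
    have h := (homotopyGroupEquivFundamentalGroupOfUnique (X := Y) (x := f x) (Fin 1)).congr_arg hp
    refine ⟨genLoopEquivOfUnique (Fin 1) p, ?_⟩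
    have h' := Path.Homotopic.Quotient.exact h
    exact h'

/-- Injectivity on `π₀` gives some path `ε` from `x` to `x'`. It is corrected by a loop lifting `δ`
followed by the inverse of `f ε`, using surjectivity on `π₁`. -/
theorem IsWeakEquiv.exists_path {X Y : Type v} [TopologicalSpace X] [TopologicalSpace Y]
    {f : C(X, Y)} (hf : IsWeakEquiv f) {x x' : X} (δ : Path (f x) (f x')) :
    ∃ δ' : Path x x', (δ'.map f.continuous).Homotopic δ := by
  obtain ⟨ε⟩ := hf.pi0_injective ⟨δ⟩
  obtain ⟨l, hl⟩ := hf.exists_loop x (δ.trans (ε.map f.continuous).symm)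
  refine ⟨l.trans ε, ?_⟩
  rw [← Path.Homotopic.Quotient.eq] at hl ⊢
  rw [Path.map_trans, Path.Homotopic.Quotient.mk_trans, hl, ← Path.Homotopic.Quotient.mk_trans,
    Path.Homotopic.Quotient.eq]
  exact (Path.Homotopic.trans_assoc _ _ _).trans
    (((Path.Homotopic.refl δ).hcomp (Path.Homotopic.symm_trans _)).trans
      (Path.Homotopic.trans_refl _))

/-! ### Path components of the homotopy fibre in terms of paths up to homotopy. -/

section Fib

variable {E F : Spectrum.{v}} {f : E ⟶ F} {n : ℤ}

/-- The path in the target underlying a point of the homotopy fibre. -/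
def Spectrum.Fib.path (p : Spectrum.Fib f n) : Path (F.pt n) (f.map n p.1.1) :=
  ⟨p.1.2, p.2.1, p.2.2⟩

/-- A path in the fibre is a map `Γ` from the square to `F_n`, constant on the edge `t = 0`. The two
ways around the boundary of the square are homotopic since the square is simply connected. -/
theorem Spectrum.Fib.homotopic_of_joined {p q : Spectrum.Fib f n} (h : Joined p q) :
    ∃ δ : Path p.1.1 q.1.1,
      (p.path.trans (δ.map (f.map n).continuous)).Homotopic q.path := by
  obtain ⟨ω⟩ := h
  have hfst : Continuous fun x : Spectrum.Fib f n => x.1.1 :=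
    continuous_fst.comp continuous_subtype_val
  let Γ : C(unitInterval × unitInterval, F.space n) :=
    ⟨fun x => (ω x.1).1.2 x.2, by
      have : Continuous fun s => (ω s).1.2 :=
        (continuous_snd.comp continuous_subtype_val).comp ω.continuous
      exact (this.comp continuous_fst).eval continuous_snd⟩
  refine ⟨ω.map hfst, ?_⟩
  let ι : Path (0 : unitInterval) 1 := ⟨ContinuousMap.id _, rfl, rfl⟩
  -- The coordinates are (fibre parameter, path parameter). `P₁` traverses `p.path` and then the
  -- image of the endpoints; `P₂` stays at the base point and then traverses `q.path`.
  let P₁ := ((Path.refl (0 : unitInterval)).prod ι).trans (ι.prod (Path.refl 1))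
  let P₂ := (ι.prod (Path.refl (0 : unitInterval))).trans ((Path.refl 1).prod ι)
  have : ContractibleSpace unitInterval := (convex_Icc (0 : ℝ) 1).contractibleSpace ⟨0, by simp⟩
  obtain ⟨K⟩ : P₁.Homotopic P₂ := SimplyConnectedSpace.paths_homotopic _ _
  have key : (p.path.trans ((ω.map hfst).map (f.map n).continuous)).Homotopic
      ((Path.refl _).trans q.path) := by
    have h₁ : ∀ t, Γ (P₁ t) =
        (p.path.trans ((ω.map hfst).map (f.map n).continuous)) t := by
      intro t
      simp only [P₁, Path.trans_apply]
      split_ifs with h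
      · exact congrArg (fun y : Spectrum.Fib f n => y.1.2 _) ω.source
      · exact (ω _).2.2
    have h₂ : ∀ t, Γ (P₂ t) = ((Path.refl (F.pt n)).trans q.path) t := by
      intro t
      simp only [P₂, Path.trans_apply]
      split_ifs with h
      · exact (ω _).2.1
      · exact congrArg (fun y : Spectrum.Fib f n => y.1.2 _) ω.target
    refine ⟨⟨⟨Γ.comp K.toContinuousMap, fun t => ?_, fun t => ?_⟩, fun t x hx => ?_⟩⟩
    · exact (congrArg Γ (K.apply_zero t)).trans (h₁ t)
    · exact (congrArg Γ (K.apply_one t)).trans (h₂ t)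
    · exact (congrArg Γ (K.eq_fst t hx)).trans (h₁ x)
  exact key.trans (Path.Homotopic.refl_trans _)

/-- First drag the endpoint of `p` along `δ`, lengthening its path to `γ`; then deform `γ` to
`q.path` with fixed endpoints. -/
theorem Spectrum.Fib.joined_of_homotopic {p q : Spectrum.Fib f n} (δ : Path p.1.1 q.1.1)
    (h : (p.path.trans (δ.map (f.map n).continuous)).Homotopic q.path) : Joined p q := by
  let γ := p.path.trans (δ.map (f.map n).continuous)
  -- At time `s` the path is the part of `γ` up to parameter `(1 + s) / 2`, which ends at the image
  -- of `δ s`. For `s = 0` it is the first half of `γ`, that is `p.path`; for `s = 1` it is all of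
  -- `γ`.
  let τ : C(unitInterval × unitInterval, unitInterval) :=
    ⟨fun x => ⟨x.2 * ((1 + x.1) / 2), by
        have h₁ := x.1.2.1
        have h₂ := x.1.2.2
        exact mul_nonneg x.2.2.1 (by linarith), by
        have h₁ := x.1.2.1
        have h₂ := x.1.2.2
        exact mul_le_one₀ x.2.2.2 (by linarith) (by linarith)⟩, by fun_prop⟩
  let r : Spectrum.Fib f n := ⟨(q.1.1, γ.toContinuousMap), γ.source, γ.target⟩
  have hγ : ∀ t, γ t = if h : (t : ℝ) ≤ 1 / 2
      then p.path ⟨2 * t, (unitInterval.mul_pos_mem_iff zero_lt_two).2 ⟨t.2.1, h⟩⟩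
      else f.map n (δ ⟨2 * t - 1, unitInterval.two_mul_sub_one_mem_iff.2
        ⟨(not_le.1 h).le, t.2.2⟩⟩) := Path.trans_apply _ _
  have hpr : Joined p r := by
    refine ⟨⟨⟨fun s => ⟨(δ s, (γ.toContinuousMap.comp τ).curry s), ?_, ?_⟩, ?_⟩, ?_, ?_⟩⟩
    · refine (congrArg γ (Subtype.ext ?_)).trans γ.source
      simp [τ]
    · refine (hγ _).trans ?_
      have hs := s.2.1
      -- The concatenation uses its first branch at parameter `1 / 2`, so `s = 0` must be treated
      -- separately.
      split_ifs with h
      · have h0 : s = 0 := Subtype.ext (by simp [τ] at h; exact le_antisymm (by change (s : ℝ) ≤ 0; linarith) hs)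
        subst h0
        refine Eq.trans (congrArg p.path (Subtype.ext ?_)) (p.path.target.trans
          (congrArg (f.map n) δ.source.symm))
        simp [τ]
      · refine congrArg (fun t => f.map n (δ t)) (Subtype.ext ?_)
        simp [τ]
        ring
    · exact (δ.continuous.prodMk (ContinuousMap.continuous _)).subtype_mk _
    · refine Subtype.ext (Prod.ext δ.source (ContinuousMap.ext fun t => ?_))
      refine (hγ _).trans ?_
      have ht := t.2.2
      rw [dif_pos (by simp [τ]; linarith)]
      refine congrArg p.path (Subtype.ext ?_)
      simp [τ]
      ring
    · refine Subtype.ext (Prod.ext δ.target (ContinuousMap.ext fun t => ?_))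
      refine congrArg γ (Subtype.ext ?_)
      simp [τ]
  obtain ⟨H⟩ := h
  have hrq : Joined r q := by
    refine ⟨⟨⟨fun s => ⟨(q.1.1, H.toContinuousMap.curry s), H.source s, H.target s⟩, ?_⟩, ?_, ?_⟩⟩
    · exact (continuous_const.prodMk (ContinuousMap.continuous _)).subtype_mk _
    · exact Subtype.ext (Prod.ext rfl (ContinuousMap.ext fun t => H.apply_zero t))
    · exact Subtype.ext (Prod.ext rfl (ContinuousMap.ext fun t => H.apply_one t))
  exact hpr.trans hrq

end Fib

/-- The map between the homotopy groups of the cofibres of `f` and `f'` induced by an equivalence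
of the sources and the identity of the targets is bijective. -/
theorem Spectrum.cofibMap_bijective {E E' F : Spectrum.{v}} {f : E ⟶ F} {f' : E' ⟶ F}
    {a : E ⟶ E'} {b : F ⟶ F} (h : a ≫ f' = f ≫ b) (n : ℤ) (ha : IsWeakEquiv (a.map n))
    (hb : b = 𝟙 F) : Function.Bijective (Spectrum.cofibMap h n) := by
  subst hb
  have hf : ∀ x, f'.map n (a.map n x) = f.map n x := fun x =>
    congrArg (fun k : E ⟶ F => Spectrum.Hom.map k n x) h
  constructor
  · intro p q hpq
    induction p using Quotient.inductionOn with | h p => ?_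
    induction q using Quotient.inductionOn with | h q => ?_
    obtain ⟨δ, hδ⟩ := Spectrum.Fib.homotopic_of_joined (zerothHomotopy_eq.1 hpq)
    -- A path joining the images in the second fibre lifts along `a`, and the homotopy condition is
    -- unchanged because `f' ∘ a = f`.
    obtain ⟨δ', hδ'⟩ := ha.exists_path δ
    refine zerothHomotopy_eq.2 (Spectrum.Fib.joined_of_homotopic δ' ?_)
    have := (((Path.Homotopic.refl _).hcomp (hδ'.map (f'.map n))).trans hδ).pathCast rfl
      (hf q.1.1).symm
    convert this using 1
    · ext t
      simp only [Path.cast_coe, Path.trans_apply]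
      split_ifs with ht
      · rfl
      · exact (hf _).symm
    · rfl
  · intro q
    induction q using Quotient.inductionOn with | h q => ?_
    obtain ⟨x, ⟨δ⟩⟩ := ha.pi0_surjective (E.pt n) q.1.1
    -- The path is chosen so that continuing it by the image of `δ` gives `q.path` up to homotopy.
    let γ := (q.path.trans (δ.map (f'.map n).continuous).symm).cast rfl (hf x).symm
    let p : Spectrum.Fib f n := ⟨(x, γ.toContinuousMap), γ.source, γ.target⟩
    refine ⟨Quotient.mk _ p, zerothHomotopy_eq.2 (Spectrum.Fib.joined_of_homotopic δ ?_)⟩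
    exact (Path.Homotopic.trans_assoc q.path _ _).trans
      (((Path.Homotopic.refl _).hcomp (Path.Homotopic.symm_trans _)).trans
        (Path.Homotopic.trans_refl _))

theorem path_homotopic_of_joined {X : Type v} [TopologicalSpace X] {x y : X} {p q : Path x y}
    (h : Joined p q) : p.Homotopic q := by
  obtain ⟨ω⟩ := h
  refine ⟨⟨⟨⟨fun z => ω z.1 z.2, ?_⟩, fun t => ?_, fun t => ?_⟩, fun t z hz => ?_⟩⟩
  · have : Continuous fun s => (ω s : C(unitInterval, X)) :=
      continuous_induced_dom.comp ω.continuous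
    exact (this.comp continuous_fst).eval continuous_snd
  · exact congrArg (fun r : Path x y => r t) ω.source
  · exact congrArg (fun r : Path x y => r t) ω.target
  · rcases hz with rfl | rfl
    · exact (ω t).source.trans p.source.symm
    · exact (ω t).target.trans p.target.symm

theorem path_joined_of_homotopic {X : Type v} [TopologicalSpace X] {x y : X} {p q : Path x y}
    (h : p.Homotopic q) : Joined p q := by
  obtain ⟨H⟩ := h
  refine ⟨⟨⟨H.eval, ?_⟩, H.eval_zero, H.eval_one⟩⟩
  exact continuous_induced_rng.2 (ContinuousMap.continuous H.toContinuousMap.curry)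

/-- If the homotopy groups of `E` vanish, then `F` has the same homotopy groups as the cofibre of
`E → F`. -/
theorem Spectrum.toCofib_bijective {E F : Spectrum.{v}} (f : E ⟶ F) (n : ℤ)
    (h : ∀ m, Subsingleton (E.Pi m)) : Function.Bijective (Spectrum.toCofib f n) := by
  -- Loops in `E_n` are, up to homotopy, points of `E_{n+1}`, and that space is path connected.
  have hloop : ∀ δ : Path (E.pt n) (E.pt n), δ.Homotopic (Path.refl _) := by
    intro δ
    obtain ⟨y, hy⟩ := (E.str_weakEquiv n).pi0_surjective (E.pt (n + 1)) δ
    have := zerothHomotopy_eq.1 ((h (n + 1)).elim (Quotient.mk _ y) (Quotient.mk _ (E.pt (n + 1))))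
    have := (hy.symm.trans (this.map (E.str n).continuous))
    rw [E.str_pt] at this
    exact path_homotopic_of_joined this
  constructor
  · intro x y hxy
    induction x using Quotient.inductionOn with | h x => ?_
    induction y using Quotient.inductionOn with | h y => ?_
    -- Both fibre points lie over the base point of `E_n`, so `δ` is a loop, hence null-homotopic,
    -- and the loops of `x` and `y` in `F_n` are homotopic.
    obtain ⟨δ, hδ⟩ := Spectrum.Fib.homotopic_of_joined (zerothHomotopy_eq.1 hxy)
    refine zerothHomotopy_eq.2 ((F.str_weakEquiv n).pi0_injective (path_joined_of_homotopic ?_))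
    have := (((Path.Homotopic.refl _).hcomp ((hloop δ).map (f.map n))).symm.trans hδ).pathCast rfl
      (f.map_pt n).symm
    refine Path.Homotopic.trans ?_ this
    refine (Path.Homotopic.trans_refl _).symm.trans ?_
    convert Path.Homotopic.refl _ using 1
    ext t
    simp only [Path.cast_coe, Path.trans_apply]
    split_ifs with ht
    · rfl
    · exact f.map_pt n
  · intro q
    induction q using Quotient.inductionOn with | h q => ?_
    obtain ⟨δ⟩ := zerothHomotopy_eq.1 ((h n).elim (Quotient.mk _ (E.pt n)) (Quotient.mk _ q.1.1))
    -- Moving `q` back along `δ` turns its path into a loop at the base point of `F_n`, which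
    -- deloops to a point of `F_{n+1}`.
    obtain ⟨x, hx⟩ := (F.str_weakEquiv n).pi0_surjective (F.pt (n + 1))
      ((q.path.trans (δ.map (f.map n).continuous).symm).cast rfl (f.map_pt n).symm)
    refine ⟨Quotient.mk _ x, zerothHomotopy_eq.2 (Spectrum.Fib.joined_of_homotopic δ ?_)⟩
    have := (((path_homotopic_of_joined hx).pathCast rfl (f.map_pt n)).hcomp
      (Path.Homotopic.refl (δ.map (f.map n).continuous)))
    exact this.trans ((Path.Homotopic.trans_assoc q.path _ _).trans
      (((Path.Homotopic.refl _).hcomp (Path.Homotopic.symm_trans _)).trans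
        (Path.Homotopic.trans_refl _)))

/-! ## Functoriality of relative homology groups -/

section Relative

variable {G : Type w} [Group G] (E : GBornCoarse.{w, u} G ⥤ Spectrum.{v}) (n : ℤ)
  {A X A' X' A'' X'' : GBornCoarse.{w, u} G} {f : A ⟶ X} {f' : A' ⟶ X'} {f'' : A'' ⟶ X''}

/-- The composites enter as variables with equations, since the squares used below often have a
third description that agrees with the composite only propositionally or by unfolding. -/
theorem relMap_relMap {a : A ⟶ A'} {b : X ⟶ X'} {a' : A' ⟶ A''} {b' : X' ⟶ X''} {a'' : A ⟶ A''}
    {b'' : X ⟶ X''} (h : a ≫ f' = f ≫ b) (h' : a' ≫ f'' = f' ≫ b') (ha : a ≫ a' = a'')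
    (hb : b ≫ b' = b'') (h'' : a'' ≫ f'' = f ≫ b'') (x : HRel E n f) :
    relMap E n h' (relMap E n h x) = relMap E n h'' x := by
  subst ha hb
  induction x using Quotient.inductionOn with | h x => ?_
  refine congrArg (Quotient.mk _) (Subtype.ext (Prod.ext ?_ (ContinuousMap.ext fun t => ?_)))
  · exact congrArg (fun k : E.obj A ⟶ E.obj A'' => Spectrum.Hom.map k n x.1.1)
      (E.map_comp a a').symm
  · exact congrArg (fun k : E.obj X ⟶ E.obj X'' => Spectrum.Hom.map k n (x.1.2 t))
      (E.map_comp b b').symm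

theorem relMap_id (h : 𝟙 A ≫ f = f ≫ 𝟙 X) (x : HRel E n f) : relMap E n h x = x := by
  induction x using Quotient.inductionOn with | h x => ?_
  refine congrArg (Quotient.mk _) (Subtype.ext (Prod.ext ?_ (ContinuousMap.ext fun t => ?_)))
  · exact congrArg (fun k : E.obj A ⟶ E.obj A => Spectrum.Hom.map k n x.1.1) (E.map_id A)
  · exact congrArg (fun k : E.obj X ⟶ E.obj X => Spectrum.Hom.map k n (x.1.2 t)) (E.map_id X)

theorem relMap_toRel {a : A ⟶ A'} {b : X ⟶ X'} (h : a ≫ f' = f ≫ b) (x : HPi E (n + 1) X) :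
    relMap E n h (toRel E n f x) = toRel E n f' (hMap E (n + 1) b x) := by
  induction x using Quotient.inductionOn with | h x => ?_
  refine congrArg (Quotient.mk _) (Subtype.ext (Prod.ext ?_ (ContinuousMap.ext fun t => ?_)))
  · exact (E.map a).map_pt n
  · exact ((E.map b).map_str n x t).symm

theorem relBoundary_relMap {a : A ⟶ A'} {b : X ⟶ X'} (h : a ≫ f' = f ≫ b) (x : HRel E n f) :
    relBoundary E n f' (relMap E n h x) = hMap E n a (relBoundary E n f x) := by
  induction x using Quotient.inductionOn with | h x => rfl

theorem hMap_id (x : HPi E n X) : hMap E n (𝟙 X) x = x := by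
  induction x using Quotient.inductionOn with | h x => ?_
  exact congrArg (Quotient.mk _)
    (congrArg (fun k : E.obj X ⟶ E.obj X => Spectrum.Hom.map k n x) (E.map_id X))

/-- Naturality of the Mayer-Vietoris boundary map for a morphism of squares which is the identity
on the total space. -/
theorem hMap_mvBoundary {P B Q C : GBornCoarse.{w, u} G} {i : P ⟶ A} {j : P ⟶ B} {a : A ⟶ X}
    {b : B ⟶ X} (h : i ≫ a = j ≫ b) (hE : IsCocartesian E h) {i' : Q ⟶ A'} {j' : Q ⟶ C}
    {a' : A' ⟶ X} {c : C ⟶ X} (h' : i' ≫ a' = j' ≫ c) (hE' : IsCocartesian E h')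
    (p : P ⟶ Q) (k : A ⟶ A') (l : B ⟶ C) (hA : k ≫ a' = a) (hB : l ≫ c = b)
    (hP : p ≫ j' = j ≫ l) (hP' : p ≫ i' = i ≫ k) (x : HPi E (n + 1) X) :
    hMap E n p (mvBoundary E h hE n x) = mvBoundary E h' hE' n x := by
  unfold mvBoundary
  set z := (Equiv.ofBijective _ (hE n)).symm (toRel E n a x)
  have hz' : relMap E n h z = toRel E n a x := (Equiv.ofBijective _ (hE n)).apply_symm_apply _
  rw [← relBoundary_relMap E n hP]
  congr 1
  -- The image of `z` is the required lift in the second square: its class in `E(X)/E(A')` is the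
  -- image of the class of `x` in `E(X)/E(A)`.
  refine ((Equiv.ofBijective _ (hE' n)).symm_apply_eq.2 ?_).symm
  have hk : k ≫ a' = a ≫ 𝟙 X := hA.trans (Category.comp_id a).symm
  have h'' : (i ≫ k) ≫ a' = j ≫ b := by rw [Category.assoc, hA, h]
  calc toRel E n a' x = toRel E n a' (hMap E (n + 1) (𝟙 X) x) := by rw [hMap_id]
    _ = relMap E n hk (toRel E n a x) := (relMap_toRel E n hk x).symm
    _ = relMap E n hk (relMap E n h z) := by rw [hz']
    _ = relMap E n h'' z := relMap_relMap E n h hk rfl (Category.comp_id b) h'' z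
    _ = relMap E n h' (relMap E n hP z) := (relMap_relMap E n hP h' hP' hB h'' z).symm

end Relative

/-! ### Invariance of relative homology under coarse equivalences of the subspace. -/

section Homology

variable {G : Type w} [Group G] (E : CoarseHomologyTheory.{w, u, v} G) (n : ℤ)
  {A X A' X' : GBornCoarse.{w, u} G} {f : A ⟶ X} {f' : A' ⟶ X'}

theorem CoarseHomologyTheory.relMap_bijective {a : A ⟶ A'} {b : X ⟶ X'} (h : a ≫ f' = f ≫ b)
    (ha : IsCoarseEquivalence a) (hb : IsIso b) :
    Function.Bijective (relMap E.functor n h) := by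
  -- The square factors into one that changes only the ambient space, by an isomorphism, and one
  -- that changes only the subspace, to which `Spectrum.cofibMap_bijective` applies.
  have h₁ : 𝟙 A ≫ (f ≫ b) = f ≫ b := Category.id_comp _
  have h₁' : 𝟙 A ≫ f = (f ≫ b) ≫ inv b := by simp
  have h₂ : a ≫ f' = (f ≫ b) ≫ 𝟙 X' := by simp [h]
  have e : relMap E.functor n h = relMap E.functor n h₂ ∘ relMap E.functor n h₁ :=
    funext fun x => (relMap_relMap E.functor n h₁ h₂ (Category.id_comp _) (Category.comp_id _) h x).symm
  rw [e]
  refine Function.Bijective.comp ?_ ?_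
  · exact Spectrum.cofibMap_bijective _ n (E.coarse_invariance a ha n) (E.functor.map_id _)
  · refine Function.bijective_iff_has_inverse.2 ⟨relMap E.functor n h₁', fun x => ?_, fun x => ?_⟩
    · rw [relMap_relMap E.functor n h₁ h₁' (Category.id_comp _) (IsIso.hom_inv_id b) (by simp),
        relMap_id]
    · rw [relMap_relMap E.functor n h₁' h₁ (Category.id_comp _) (IsIso.inv_hom_id b) (by simp),
        relMap_id]

end Homology

/-! ## Embeddings of bornological coarse spaces -/

section Embedding

variable {G : Type w} [Group G]

/-- Injective morphisms whose source carries the structures induced from the target. -/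
structure IsCoarseEmbedding {X Y : GBornCoarse.{w, u} G} (f : X ⟶ Y) : Prop where
  injective : Function.Injective f.toFun
  mem_entourages : ∀ U : Set (X.carrier × X.carrier),
    Prod.map f.toFun f.toFun '' U ∈ Y.coarse.entourages → U ∈ X.coarse.entourages
  bounded_image : ∀ B : Set X.carrier, Bornology.IsBounded B → Bornology.IsBounded (f.toFun '' B)

variable {X Y Z : GBornCoarse.{w, u} G}

theorem GBornCoarse.isCoarseEmbedding_ι (S : SubMulAction G X.carrier) :
    IsCoarseEmbedding (X.ι S) where
  injective := Subtype.val_injective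
  mem_entourages := fun _ hU => hU
  bounded_image := fun _ hB => Bornology.isBounded_image_subtype_val.2 hB

theorem IsCoarseEmbedding.comp {f : X ⟶ Y} {g : Y ⟶ Z} (hf : IsCoarseEmbedding f)
    (hg : IsCoarseEmbedding g) : IsCoarseEmbedding (f ≫ g) where
  injective := hg.injective.comp hf.injective
  mem_entourages := fun U hU => hf.mem_entourages U (hg.mem_entourages _ (by
    rw [← Set.image_comp, Prod.map_comp_map]
    exact hU))
  bounded_image := fun B hB => by
    have := hg.bounded_image _ (hf.bounded_image B hB)
    rwa [← Set.image_comp] at this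

/-- Control of `g` pushes entourages on to `Z`, and properness of `g` pulls bounded sets back to
`Y`; so the structures induced by `f` agree with those induced by the composite. -/
theorem IsCoarseEmbedding.of_comp {f : X ⟶ Y} {g : Y ⟶ Z} (h : IsCoarseEmbedding (f ≫ g)) :
    IsCoarseEmbedding f where
  injective := Function.Injective.of_comp (f := g.toFun) h.injective
  mem_entourages := fun U hU => h.mem_entourages U (by
    have := g.controlled _ hU
    rwa [← Set.image_comp, Prod.map_comp_map] at this)
  bounded_image := fun B hB => (g.proper _ (h.bounded_image B hB)).subset (by
    rintro _ ⟨x, hx, rfl⟩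
    exact ⟨x, hx, rfl⟩)

theorem IsCoarseEmbedding.lift {f : X ⟶ Y} (hf : IsCoarseEmbedding f)
    (T : SubMulAction G Y.carrier) (h : ∀ x, f.toFun x ∈ T) :
    IsCoarseEmbedding (GBornCoarse.lift f T h) :=
  IsCoarseEmbedding.of_comp (g := Y.ι T) hf

/-- An embedding is a coarse equivalence if its target can be moved equivariantly into its image
by a map which is close to the identity. -/
theorem IsCoarseEmbedding.isCoarseEquivalence {f : X ⟶ Y} (hf : IsCoarseEmbedding f)
    (ρ : Y.carrier → Y.carrier) (hρ : ∀ (g : G) y, ρ (g • y) = g • ρ y)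
    (hmem : ∀ y, ρ y ∈ Set.range f.toFun)
    (hclose : {p : Y.carrier × Y.carrier | ∃ y, p = (ρ y, y)} ∈ Y.coarse.entourages) :
    IsCoarseEquivalence f := by
  choose r hr using hmem
  refine ⟨⟨r, fun g y => hf.injective ?_, fun U hU => hf.mem_entourages _ ?_, fun B hB => ?_⟩,
    hf.mem_entourages _ ?_, ?_⟩
  · rw [f.equivariant, hr, hr, hρ]
  · refine Y.coarse.subset_mem
      (Y.coarse.comp_mem hclose (Y.coarse.comp_mem hU (Y.coarse.inv_mem hclose))) ?_
    rintro _ ⟨_, ⟨⟨x, y⟩, hxy, rfl⟩, rfl⟩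
    exact ⟨x, ⟨x, Prod.ext (hr x) rfl⟩, y, hxy, ⟨y, Prod.ext (hr y) rfl⟩⟩
  · refine (Y.thicken_bounded _ (Y.coarse.inv_mem hclose) _ (hf.bounded_image B hB)).subset ?_
    intro y hy
    exact ⟨f.toFun (r y), ⟨r y, hy, rfl⟩, ⟨y, Prod.ext (hr y) rfl⟩⟩
  · refine Y.coarse.subset_mem hclose ?_
    rintro _ ⟨_, ⟨x, rfl⟩, rfl⟩
    exact ⟨f.toFun x, Prod.ext (hr _) rfl⟩
  · refine Y.coarse.subset_mem hclose ?_
    rintro _ ⟨y, rfl⟩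
    exact ⟨y, Prod.ext (hr _) rfl⟩

theorem IsCoarseEmbedding.isIso {f : X ⟶ Y} (hf : IsCoarseEmbedding f)
    (hs : Function.Surjective f.toFun) : IsIso f := by
  choose r hr using hs
  have hrf : ∀ x, r (f.toFun x) = x := fun x => hf.injective (hr _)
  refine ⟨⟨r, fun g y => hf.injective ?_, fun U hU => hf.mem_entourages _ ?_, fun B hB => ?_⟩,
    GBornCoarse.hom_ext hrf, GBornCoarse.hom_ext hr⟩
  · rw [f.equivariant, hr, hr]
  · refine Y.coarse.subset_mem hU ?_
    rintro _ ⟨_, ⟨⟨x, y⟩, hxy, rfl⟩, rfl⟩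
    simpa [hr] using hxy
  · refine (hf.bounded_image B hB).subset fun y hy => ⟨r y, hy, hr y⟩

/-- The image of a morphism. -/
def GBornCoarse.image (f : X ⟶ Y) : SubMulAction G Y.carrier where
  carrier := Set.range f.toFun
  smul_mem' := by
    rintro g _ ⟨x, rfl⟩
    exact ⟨g • x, f.equivariant g x⟩

/-- The big family of the invariant subsets which contain `A` and on which `ρ` is close to the
identity. -/
def BigFamily.ofRetraction (A : SubMulAction G X.carrier) (ρ : X.carrier → X.carrier)
    (hmem : ∀ x, ρ x ∈ A)
    (hclose : ∀ V ∈ X.coarse.entourages,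
      {p : X.carrier × X.carrier | ∃ x ∈ thicken V (A : Set X.carrier), p = (ρ x, x)} ∈
        X.coarse.entourages) : BigFamily X where
  members := {T | A ≤ T ∧
    {p : X.carrier × X.carrier | ∃ x ∈ T, p = (ρ x, x)} ∈ X.coarse.entourages}
  nonempty := by
    refine ⟨A, le_rfl, X.coarse.subset_mem (hclose _ X.coarse.diag_mem) ?_⟩
    rintro _ ⟨x, hx, rfl⟩
    exact ⟨x, ⟨x, hx, rfl⟩, rfl⟩
  directed := fun S hS T hT => by
    refine ⟨S ⊔ T, ⟨hS.1.trans le_sup_left, ?_⟩, le_sup_left, le_sup_right⟩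
    refine X.coarse.subset_mem (X.coarse.union_mem hS.2 hT.2) ?_
    rintro _ ⟨x, hx | hx, rfl⟩
    · exact Or.inl ⟨x, hx, rfl⟩
    · exact Or.inr ⟨x, hx, rfl⟩
  big := fun T hT U hU => by
    obtain ⟨V, hV, hUV, hi⟩ := X.exists_invariant U hU
    let T' : SubMulAction G X.carrier :=
      { carrier := (T : Set X.carrier) ∪ thicken V T
        smul_mem' := fun g x hx => hx.imp (T.smul_mem g)
          fun ⟨a, ha, h⟩ => ⟨g • a, T.smul_mem g ha, hi g _ _ h⟩ }
    -- Points of `T` are close to their `ρ`-images in `A`, so `T` together with `V[T]` lies in a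
    -- thickening of `A`, where `hclose` controls `ρ`.
    have hC := X.coarse.inv_mem hT.2
    refine ⟨T', ⟨hT.1.trans fun x hx => Or.inl hx, ?_⟩,
      fun x ⟨a, ha, h⟩ => Or.inr ⟨a, ha, hUV h⟩⟩
    refine X.coarse.subset_mem
      (hclose _ (X.coarse.union_mem hC (X.coarse.comp_mem hV hC))) ?_
    rintro _ ⟨x, hx | ⟨a, ha, h⟩, rfl⟩
    · exact ⟨x, ⟨ρ x, hmem x, Or.inl ⟨x, hx, rfl⟩⟩, rfl⟩
    · exact ⟨x, ⟨ρ a, hmem a, Or.inr ⟨a, h, ⟨a, ha, rfl⟩⟩⟩, rfl⟩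

/-- A square of embeddings is sent to a cocartesian square if the neighbourhoods of `A` can be
moved into `A` by an equivariant map which preserves `B`. -/
theorem CoarseHomologyTheory.isCocartesian_of_retraction (E : CoarseHomologyTheory.{w, u, v} G)
    {P A B X : GBornCoarse.{w, u} G} {i : P ⟶ A} {j : P ⟶ B} {a : A ⟶ X} {b : B ⟶ X}
    (h : i ≫ a = j ≫ b) (ha : IsCoarseEmbedding a) (hb : IsCoarseEmbedding b)
    (hi : IsCoarseEmbedding i)
    (hcover : ∀ x, x ∈ Set.range a.toFun ∨ x ∈ Set.range b.toFun)
    (hinter : ∀ y z, a.toFun y = b.toFun z → y ∈ Set.range i.toFun)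
    (ρ : X.carrier → X.carrier) (hρ : ∀ (g : G) x, ρ (g • x) = g • ρ x)
    (hmem : ∀ x, ρ x ∈ Set.range a.toFun)
    (hpres : ∀ x, ρ (b.toFun x) ∈ Set.range b.toFun)
    (hclose : ∀ V ∈ X.coarse.entourages,
      {p : X.carrier × X.carrier | ∃ x ∈ thicken V (Set.range a.toFun), p = (ρ x, x)} ∈
        X.coarse.entourages) : IsCocartesian E.functor h := by
  intro n
  let 𝒴 := BigFamily.ofRetraction (GBornCoarse.image a) ρ hmem hclose
  let Z := GBornCoarse.image b
  -- On the image of `B`, `ρ` takes values in the images of both `A` and `B`, hence in that of `P`.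
  have hmemP : ∀ x ∈ Z, ρ x ∈ Set.range (i ≫ a).toFun := by
    rintro _ ⟨z, rfl⟩
    obtain ⟨y, hy⟩ := hmem (b.toFun z)
    obtain ⟨z', hz'⟩ := hpres z
    obtain ⟨p, rfl⟩ := hinter y z' (hy.trans hz'.symm)
    exact ⟨p, hy⟩
  have hPZ : ∀ p, (i ≫ a).toFun p ∈ Z := fun p => by
    rw [h]
    exact ⟨j.toFun p, rfl⟩
  let α : ∀ T ∈ 𝒴.members, A ⟶ X.sub T := fun T hT =>
    GBornCoarse.lift a T fun y => hT.1 ⟨y, rfl⟩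
  let π : ∀ T ∈ 𝒴.members, P ⟶ X.sub (Z ⊓ T) := fun T hT =>
    GBornCoarse.lift (i ≫ a) (Z ⊓ T) fun p => ⟨hPZ p, hT.1 ⟨i.toFun p, rfl⟩⟩
  let β : B ⟶ X.sub Z := GBornCoarse.lift b Z fun x => ⟨x, rfl⟩
  -- On a member `T` of the family, `ρ` is close to the identity and moves `T` into `A` and `Z ∩ T`
  -- into `P`. So all members have the homology of `A`, and all their intersections with `Z` that of
  -- `P`.
  have hα : ∀ T hT, IsCoarseEquivalence (α T hT) := by
    intro T hT
    refine (ha.lift T _).isCoarseEquivalence (fun x => ⟨ρ x.1, hT.1 (hmem x.1)⟩)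
      (fun g x => Subtype.ext (hρ g x.1)) (fun x => ?_) (X.coarse.subset_mem hT.2 ?_)
    · obtain ⟨y, hy⟩ := hmem x.1
      exact ⟨y, Subtype.ext hy⟩
    · rintro _ ⟨_, ⟨x, rfl⟩, rfl⟩
      exact ⟨x.1, x.2, rfl⟩
  have hπ : ∀ T hT, IsCoarseEquivalence (π T hT) := by
    intro T hT
    refine ((hi.comp ha).lift (Z ⊓ T) _).isCoarseEquivalence
      (fun x => ⟨ρ x.1, by
        obtain ⟨p, hp⟩ := hmemP x.1 x.2.1
        exact hp ▸ hPZ p, hT.1 (hmem x.1)⟩)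
      (fun g x => Subtype.ext (hρ g x.1)) (fun x => ?_) (X.coarse.subset_mem hT.2 ?_)
    · obtain ⟨y, hy⟩ := hmemP x.1 x.2.1
      exact ⟨y, Subtype.ext hy⟩
    · rintro _ ⟨_, ⟨x, rfl⟩, rfl⟩
      exact ⟨x.1, x.2.2, rfl⟩
  have hβ : IsIso β := (hb.lift Z _).isIso (by
    rintro ⟨_, x, rfl⟩
    exact ⟨x, rfl⟩)
  have hsqα : ∀ T hT, α T hT ≫ X.ι T = a ≫ 𝟙 X := fun T hT => rfl
  have hsqπ : ∀ T hT, π T hT ≫ GBornCoarse.inclusion (inf_le_left : Z ⊓ T ≤ Z) = j ≫ β :=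
    fun T hT => GBornCoarse.hom_ext fun p => Subtype.ext (congrArg (fun k => k.toFun p) h)
  have hbα : ∀ T hT, Function.Bijective (relMap E.functor n (hsqα T hT)) := fun T hT =>
    E.relMap_bijective n _ (hα T hT) inferInstance
  have hbπ : ∀ T hT, Function.Bijective (relMap E.functor n (hsqπ T hT)) := fun T hT =>
    E.relMap_bijective n _ (hπ T hT) hβ
  have hsqZ : ∀ T, GBornCoarse.inclusion (inf_le_right : Z ⊓ T ≤ T) ≫ X.ι T =
    GBornCoarse.inclusion (inf_le_left : Z ⊓ T ≤ Z) ≫ X.ι Z := fun T => rfl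
  -- Under these bijections the excision map of every stage `T` becomes the map of the given square.
  -- The colimit statement of the excision axiom thus reduces to bijectivity of this one map.
  have hcomm : ∀ T hT x, relMap E.functor n (hsqZ T) (relMap E.functor n (hsqπ T hT) x) =
      relMap E.functor n (hsqα T hT) (relMap E.functor n h x) := by
    intro T hT x
    have h₃ : (i ≫ α T hT) ≫ X.ι T = j ≫ b := h
    rw [relMap_relMap E.functor n (hsqπ T hT) (hsqZ T) (a'' := i ≫ α T hT) (b'' := b) rfl rfl h₃,
      relMap_relMap E.functor n h (hsqα T hT) rfl (Category.comp_id b) h₃]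
  obtain ⟨T₀, hT₀⟩ := 𝒴.nonempty
  have hexc := E.excision X Z 𝒴 ⟨T₀, hT₀, by
    refine eq_top_iff.2 fun x _ => (hcover x).symm.imp id fun hx => hT₀.1 hx⟩ n
  constructor
  · intro x x' hxx'
    have := (hcomm T₀ hT₀ x).trans ((congrArg _ hxx').trans (hcomm T₀ hT₀ x').symm)
    obtain ⟨T, hT, hle, hz⟩ := hexc.2 T₀ hT₀ _ _ this
    have hsq : GBornCoarse.inclusion (inf_le_inf_left Z hle) ≫
        GBornCoarse.inclusion (inf_le_left : Z ⊓ T ≤ Z) =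
        GBornCoarse.inclusion (inf_le_left : Z ⊓ T₀ ≤ Z) ≫ 𝟙 (X.sub Z) := rfl
    have e : ∀ x, relMap E.functor n hsq (relMap E.functor n (hsqπ T₀ hT₀) x) =
        relMap E.functor n (hsqπ T hT) x :=
      relMap_relMap E.functor n (hsqπ T₀ hT₀) hsq rfl (Category.comp_id β) (hsqπ T hT)
    exact (hbπ T hT).1 ((e x).symm.trans (hz.trans (e x')))
  · intro y
    obtain ⟨T, hT, hle, z, hz⟩ := hexc.1 T₀ hT₀ (relMap E.functor n (hsqα T₀ hT₀) y)
    obtain ⟨x, rfl⟩ := (hbπ T hT).2 z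
    refine ⟨x, (hbα T hT).1 ?_⟩
    have hsq : GBornCoarse.inclusion hle ≫ X.ι T = X.ι T₀ ≫ 𝟙 X := rfl
    have e : relMap E.functor n hsq (relMap E.functor n (hsqα T₀ hT₀) y) =
        relMap E.functor n (hsqα T hT) y :=
      relMap_relMap E.functor n (hsqα T₀ hT₀) hsq rfl (Category.comp_id _) (hsqα T hT) y
    exact (hcomm T hT x).symm.trans (hz.trans e)

end Embedding

/-! ## Retractions of cones -/

section Cones

variable {G : Type w} [Group G]

theorem isCoarseEmbedding_coneMinusZero (X : GUBC.{w, u} G) :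
    IsCoarseEmbedding (coneMinusZero X) where
  injective := fun _ _ h => congrArg (Prod.snd : ℝ × X.carrier → X.carrier) h
  mem_entourages := fun U hU => X.coarse.subset_mem hU.1.2 (by
    rintro p hp
    exact ⟨_, ⟨p, hp, rfl⟩, rfl⟩)
  bounded_image := fun B hB => by
    refine Bornology.isBounded_image_fst_and_snd.1
      ⟨(Bornology.isBounded_singleton (x := (0 : ℝ))).subset ?_, hB.subset ?_⟩
    · rintro _ ⟨_, ⟨x, hx, rfl⟩, rfl⟩
      rfl
    · rintro _ ⟨_, ⟨x, hx, rfl⟩, rfl⟩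
      exact hx

theorem isCoarseEmbedding_coneMinusMap_ι (X : GUBC.{w, u} G) (S : SubMulAction G X.carrier) :
    IsCoarseEmbedding (coneMinusMap (X.ι S)) where
  injective := fun p q h => by
    have h₁ := congrArg (Prod.fst : ℝ × X.carrier → ℝ) h
    have h₂ := congrArg (Prod.snd : ℝ × X.carrier → X.carrier) h
    exact Prod.ext h₁ (Subtype.ext h₂)
  mem_entourages := fun U hU => by
    refine ⟨⟨?_, X.coarse.subset_mem hU.1.2 ?_⟩, fun V hV => ?_⟩
    · obtain ⟨r, hr⟩ := hU.1.1
      exact ⟨r, fun p hp => hr _ ⟨p, hp, rfl⟩⟩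
    · rintro _ ⟨_, ⟨p, hp, rfl⟩, rfl⟩
      exact ⟨_, ⟨p, hp, rfl⟩, rfl⟩
    · have hind : IsUniformInducing (Prod.map id Subtype.val : ℝ × S → ℝ × X.carrier) :=
        (IsUniformInducing.id).prod (isUniformEmbedding_subtype_val (p := (· ∈ S))).1
      have hV' : V ∈ uniformity (ℝ × S) := hV
      rw [← hind.comap_uniformity] at hV'
      obtain ⟨T, hT, hTV⟩ := Filter.mem_comap.1 hV'
      obtain ⟨n, hn⟩ := hU.2 T hT
      exact ⟨n, fun p hp => (hn _ ⟨p, hp, rfl⟩).imp_left fun h => hTV h⟩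
  bounded_image := fun B hB => by
    have hB' := Bornology.isBounded_image_fst_and_snd.2 hB
    refine Bornology.isBounded_image_fst_and_snd.1 ⟨hB'.1.subset ?_,
      (Bornology.isBounded_image_subtype_val.2 hB'.2).subset ?_⟩
    · rintro _ ⟨_, ⟨x, hx, rfl⟩, rfl⟩
      exact ⟨x, hx, rfl⟩
    · rintro _ ⟨_, ⟨x, hx, rfl⟩, rfl⟩
      exact ⟨_, ⟨x, hx, rfl⟩, rfl⟩

theorem isCoarseEmbedding_inclusion {X : GBornCoarse.{w, u} G} {S T : SubMulAction G X.carrier}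
    (h : S ≤ T) : IsCoarseEmbedding (GBornCoarse.inclusion h) :=
  (GBornCoarse.isCoarseEmbedding_ι S).lift T _

theorem isCoarseEmbedding_subZero (X : GUBC.{w, u} G) (S : SubMulAction G X.carrier)
    (T : SubMulAction G (coneMinus X).carrier) (h : slab X {0} S ≤ T) :
    IsCoarseEmbedding (subZero X S T h) :=
  ((GBornCoarse.isCoarseEmbedding_ι S).comp (isCoarseEmbedding_coneMinusZero X)).lift T _

theorem isCoarseEmbedding_subCone (X : GUBC.{w, u} G) (S : SubMulAction G X.carrier)
    (T : SubMulAction G (coneMinus X).carrier) (h : slab X (Set.Ici 0) S ≤ T) :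
    IsCoarseEmbedding (subCone X S T h) :=
  ((GBornCoarse.isCoarseEmbedding_ι _).comp (isCoarseEmbedding_coneMinusMap_ι X S)).lift T _

/-! ### Extending a retraction of the base to the cone. -/

/-- The map `(t, x) ↦ (min t 0, r x)`. -/
def lowerRetraction (X : GUBC.{w, u} G) (r : X.carrier → X.carrier) :
    (coneMinus X).carrier → (coneMinus X).carrier :=
  fun p : ℝ × X.carrier => ((min p.1 0, r p.2) : ℝ × X.carrier)

/-- The map `(t, x) ↦ (t, r x)`. -/
def cylinderRetraction (X : GUBC.{w, u} G) (r : X.carrier → X.carrier) :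
    (coneMinus X).carrier → (coneMinus X).carrier :=
  fun p : ℝ × X.carrier => ((p.1, r p.2) : ℝ × X.carrier)

/-- `r` is close to the identity on every coarse thickening of `W`. -/
def IsCoarseRetraction (X : GBornCoarse.{w, u} G) (W : SubMulAction G X.carrier)
    (r : X.carrier → X.carrier) : Prop :=
  ∀ U ∈ X.coarse.entourages,
    {p : X.carrier × X.carrier | ∃ x ∈ thicken U (W : Set X.carrier), p = (r x, x)} ∈
      X.coarse.entourages

/-- `r` is uniformly close to the identity on small uniform thickenings of `W`. -/
def IsUniformRetraction (X : GUBC.{w, u} G) (W : SubMulAction G X.carrier)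
    (r : X.carrier → X.carrier) : Prop :=
  ∀ Q ∈ uniformity X.carrier, ∃ U ∈ uniformity X.carrier,
    ∀ x ∈ thicken U (W : Set X.carrier), (r x, x) ∈ Q

/-- An entourage of propagation `R` thickens `(-∞, 0] × W` only up to height `R`. There the height
moves by at most `R`, and the hybrid condition is void, so coarse closeness of `r` suffices. -/
theorem IsCoarseRetraction.lower {X : GUBC.{w, u} G} {W : SubMulAction G X.carrier}
    {r : X.carrier → X.carrier} (hr : IsCoarseRetraction X.toGBornCoarse W r) :
    IsCoarseRetraction (coneMinus X) (slab X (Set.Iic 0) W) (lowerRetraction X r) := by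
  intro V hV
  obtain ⟨R, hR⟩ := hV.1.1
  have hle : ∀ p ∈ thicken V (slab X (Set.Iic 0) W : Set (coneMinus X).carrier),
      (p : ℝ × X.carrier).1 ≤ R := by
    rintro p ⟨q, hq, hpq⟩
    have h₁ := (abs_le.1 (hR _ hpq)).2
    have h₂ : (q : ℝ × X.carrier).1 ≤ 0 := hq.1
    dsimp only at h₁
    linarith
  refine ⟨⟨⟨|R|, ?_⟩, X.coarse.subset_mem (hr _ hV.1.2) ?_⟩, fun T hT => ?_⟩
  · rintro _ ⟨p, hp, rfl⟩
    have h₁ := (hle p hp).trans (le_abs_self R)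
    change |min (p : ℝ × X.carrier).1 0 - (p : ℝ × X.carrier).1| ≤ |R|
    rcases le_total (p : ℝ × X.carrier).1 0 with h | h
    · rw [min_eq_left h, sub_self, abs_zero]
      exact abs_nonneg R
    · rw [min_eq_right h, zero_sub, abs_neg, abs_of_nonneg h]
      exact h₁
  · rintro _ ⟨_, ⟨p, ⟨q, hq, hpq⟩, rfl⟩, rfl⟩
    exact ⟨(p : ℝ × X.carrier).2, ⟨(q : ℝ × X.carrier).2, hq.2, ⟨_, hpq, rfl⟩⟩, rfl⟩
  · obtain ⟨n, hn⟩ := exists_nat_ge R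
    refine ⟨n, ?_⟩
    rintro _ ⟨p, hp, rfl⟩
    have h₁ := (hle p hp).trans hn
    exact Or.inr ⟨(min_le_left _ _).trans h₁, h₁⟩

/-- Heights are fixed but unbounded, so the hybrid condition matters. Above some height `n` the
entourage `V` is as small as desired in the `X`-direction, so points of the thickening lie in a
small uniform thickening of `W`, where `r` is uniformly close to the identity. -/
theorem IsCoarseRetraction.cylinder {X : GUBC.{w, u} G} {W : SubMulAction G X.carrier}
    {r : X.carrier → X.carrier} (hr : IsCoarseRetraction X.toGBornCoarse W r)
    (hr' : IsUniformRetraction X W r) :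
    IsCoarseRetraction (coneMinus X) (slab X Set.univ W) (cylinderRetraction X r) := by
  intro V hV
  refine ⟨⟨⟨0, ?_⟩, X.coarse.subset_mem (hr _ hV.1.2) ?_⟩, fun T hT => ?_⟩
  · rintro _ ⟨p, -, rfl⟩
    exact (by simp : |(p : ℝ × X.carrier).1 - (p : ℝ × X.carrier).1| ≤ 0)
  · rintro _ ⟨_, ⟨p, ⟨q, hq, hpq⟩, rfl⟩, rfl⟩
    exact ⟨(p : ℝ × X.carrier).2, ⟨(q : ℝ × X.carrier).2, hq.2, ⟨_, hpq, rfl⟩⟩, rfl⟩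
  · rw [uniformity_prod_eq_comap_prod, Filter.mem_comap] at hT
    obtain ⟨T', hT', hT'T⟩ := hT
    obtain ⟨A, hA, Q, hQ, hAQ⟩ := Filter.mem_prod_iff.1 hT'
    obtain ⟨U, hU, hUQ⟩ := hr' Q hQ
    obtain ⟨n, hn⟩ := hV.2 _ ((uniformContinuous_snd : UniformContinuous
      (Prod.snd : ℝ × X.carrier → X.carrier)) hU)
    refine ⟨n, ?_⟩
    rintro _ ⟨p, ⟨q, hq, hpq⟩, rfl⟩
    refine (hn _ hpq).imp (fun h => hT'T (hAQ ⟨refl_mem_uniformity hA, ?_⟩))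
      (fun h => ⟨h.1, h.1⟩)
    exact hUQ (p : ℝ × X.carrier).2 ⟨(q : ℝ × X.carrier).2, hq.2, h⟩

/-- Excision in an invariant subset `S` of `X` for two invariant subsets `A` and `B` of `S`. -/
theorem CoarseHomologyTheory.isCocartesian_inclusion (E : CoarseHomologyTheory.{w, u, v} G)
    {X : GBornCoarse.{w, u} G} {S A B : SubMulAction G X.carrier} {P : GBornCoarse.{w, u} G}
    {i : P ⟶ X.sub A} {j : P ⟶ X.sub B} (hA : A ≤ S) (hB : B ≤ S)
    (h : i ≫ GBornCoarse.inclusion hA = j ≫ GBornCoarse.inclusion hB) (hi : IsCoarseEmbedding i)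
    (hcover : S ≤ A ⊔ B)
    (hinter : ∀ x (hx : x ∈ A), x ∈ B → (⟨x, hx⟩ : A) ∈ Set.range i.toFun)
    (ρ : X.carrier → X.carrier) (hρ : ∀ (g : G) x, ρ (g • x) = g • ρ x)
    (hmem : ∀ x ∈ S, ρ x ∈ A) (hpres : ∀ x ∈ B, ρ x ∈ B) (hclose : IsCoarseRetraction X A ρ) :
    IsCocartesian E.functor h := by
  refine E.isCocartesian_of_retraction h (isCoarseEmbedding_inclusion hA)
    (isCoarseEmbedding_inclusion hB) hi (fun x => ?_) (fun y z hyz => ?_)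
    (fun x => ⟨ρ x.1, hA (hmem x.1 x.2)⟩) (fun g x => Subtype.ext (hρ g x.1))
    (fun x => ⟨⟨ρ x.1, hmem x.1 x.2⟩, rfl⟩)
    (fun x => ⟨⟨ρ x.1, hpres x.1 x.2⟩, rfl⟩) (fun V hV => ?_)
  · exact (hcover x.2).imp (fun hx => ⟨⟨x.1, hx⟩, rfl⟩) (fun hx => ⟨⟨x.1, hx⟩, rfl⟩)
  · refine hinter y.1 y.2 ?_
    have : y.1 = z.1 := congrArg Subtype.val hyz
    exact this ▸ z.2
  · refine X.coarse.subset_mem (hclose _ hV) ?_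
    rintro _ ⟨_, ⟨x, ⟨_, ⟨y, rfl⟩, hy⟩, rfl⟩, rfl⟩
    exact ⟨x.1, ⟨y.1, y.2, ⟨_, hy, rfl⟩⟩, rfl⟩

/-! ## The comparison map for cones -/

/-- The retraction criterion applies with `r = id`: the map `(t, x) ↦ (min t 0, x)` retracts onto
the lower half and sends the cone to `{0} × X`. -/
theorem coneSquare_isCocartesian (E : CoarseHomologyTheory.{w, u, v} G) (X : GUBC.{w, u} G) :
    IsCocartesian E.functor (coneSquare X) := by
  have hid : IsCoarseRetraction X.toGBornCoarse ⊤ id := by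
    refine fun U hU => X.coarse.subset_mem X.coarse.diag_mem ?_
    rintro _ ⟨x, -, rfl⟩
    rfl
  refine E.isCocartesian_of_retraction (coneSquare X) (GBornCoarse.isCoarseEmbedding_ι _)
    (GBornCoarse.isCoarseEmbedding_ι _) ((isCoarseEmbedding_coneMinusZero X).lift _ _)
    (fun x => ?_) (fun y z hyz => ?_) (lowerRetraction X id) (fun g x => rfl)
    (fun x => ⟨⟨lowerRetraction X id x,
      (min_le_right _ _ : min (x : ℝ × X.carrier).1 0 ≤ 0), trivial⟩, rfl⟩)
    (fun x => ⟨⟨lowerRetraction X id x.1,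
      (le_min x.2.1 le_rfl : (0 : ℝ) ≤ min (x.1 : ℝ × X.carrier).1 0), trivial⟩, rfl⟩) (fun V hV => ?_)
  · exact (le_total (x : ℝ × X.carrier).1 0).imp (fun h => ⟨⟨x, h, trivial⟩, rfl⟩)
      (fun h => ⟨⟨x, h, trivial⟩, rfl⟩)
  · obtain ⟨⟨t, x⟩, hy⟩ := y
    obtain ⟨⟨t', x'⟩, hz⟩ := z
    have ht : t = t' := congrArg (Prod.fst : ℝ × X.carrier → ℝ) hyz
    have h0 : (0 : ℝ) = t := le_antisymm (ht ▸ hz.1) hy.1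
    exact ⟨x, Subtype.ext (Prod.ext h0 rfl)⟩
  · refine (coneMinus X).coarse.subset_mem (hid.lower V hV) ?_
    rintro _ ⟨x, ⟨_, ⟨y, rfl⟩, hy⟩, rfl⟩
    exact ⟨x, ⟨y.1, y.2, hy⟩, rfl⟩

/-! ### Flasqueness of the lower half. -/

/-- On `(-∞, 0] × X` the hybrid structure is the structure of `ℝ ⊗ X`. -/
theorem mem_entourages_lowerHalf {X : GUBC.{w, u} G}
    {U : Set (((coneMinus X).sub (lowerHalf X)).carrier ×
      ((coneMinus X).sub (lowerHalf X)).carrier)}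
    (hU : Prod.map Subtype.val Subtype.val '' U ∈ X.coarse.realProd.entourages) :
    U ∈ ((coneMinus X).sub (lowerHalf X)).coarse.entourages := by
  refine ⟨hU, fun V _ => ⟨0, ?_⟩⟩
  rintro _ ⟨p, -, rfl⟩
  rw [Nat.cast_zero]
  exact Or.inr ⟨p.1.2.1, p.2.2.1⟩

/-- The shift `(t, x) ↦ (t - 1, x)`. -/
def lowerShift (X : GUBC.{w, u} G) :
    (coneMinus X).sub (lowerHalf X) ⟶ (coneMinus X).sub (lowerHalf X) where
  toFun := fun p => ⟨((p.1 : ℝ × X.carrier).1 - 1, (p.1 : ℝ × X.carrier).2), by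
    have h : (p.1 : ℝ × X.carrier).1 ≤ 0 := p.2.1
    exact (by linarith : (p.1 : ℝ × X.carrier).1 - 1 ≤ 0), trivial⟩
  equivariant := fun _ _ => rfl
  controlled := fun U hU => by
    refine mem_entourages_lowerHalf ⟨?_, X.coarse.subset_mem hU.1.2 ?_⟩
    · obtain ⟨r, hr⟩ := hU.1.1
      refine ⟨r, ?_⟩
      rintro _ ⟨_, ⟨p, hp, rfl⟩, rfl⟩
      have := hr _ ⟨p, hp, rfl⟩
      dsimp only [Prod.map] at this ⊢
      rwa [sub_sub_sub_cancel_right]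
    · rintro _ ⟨_, ⟨_, ⟨p, hp, rfl⟩, rfl⟩, rfl⟩
      exact ⟨_, ⟨p, hp, rfl⟩, rfl⟩
  proper := fun B hB => by
    have hB' := Bornology.isBounded_image_fst_and_snd.2
      (Bornology.isBounded_image_subtype_val.2 hB)
    refine Bornology.isBounded_image_subtype_val.1 (Bornology.isBounded_image_fst_and_snd.1
      ⟨(hB'.1.cthickening (δ := 1)).subset ?_, hB'.2.subset ?_⟩)
    · rintro _ ⟨_, ⟨p, hp, rfl⟩, rfl⟩
      refine Metric.mem_cthickening_of_dist_le _ ((p.1 : ℝ × X.carrier).1 - 1) 1 _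
        ⟨_, ⟨_, hp, rfl⟩, rfl⟩ ?_
      simp
    · rintro _ ⟨_, ⟨p, hp, rfl⟩, rfl⟩
      exact ⟨_, ⟨_, hp, rfl⟩, rfl⟩

theorem lowerShift_iterate (X : GUBC.{w, u} G) (n : ℕ)
    (p : ((coneMinus X).sub (lowerHalf X)).carrier) :
    (((lowerShift X).toFun^[n] p).1 : ℝ × X.carrier) =
      ((p.1 : ℝ × X.carrier).1 - n, (p.1 : ℝ × X.carrier).2) := by
  induction n with
  | zero => exact Prod.ext (by simp) rfl
  | succ n ih =>
    rw [Function.iterate_succ_apply']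
    have h := congrArg (Prod.snd : ℝ × X.carrier → X.carrier) ih
    refine Prod.ext ?_ h
    refine (congrArg (fun q : ℝ × X.carrier => q.1 - 1) ih).trans ?_
    push_cast
    ring

/-- The unit shift towards `-∞` preserves height differences and `X`-coordinates, so all its
iterates satisfy the same bounds; and it eventually leaves every bounded set. -/
theorem isFlasque_lowerHalf (X : GUBC.{w, u} G) :
    IsFlasque ((coneMinus X).sub (lowerHalf X)) := by
  refine ⟨lowerShift X, mem_entourages_lowerHalf ⟨⟨1, ?_⟩, X.coarse.subset_mem X.coarse.diag_mem ?_⟩,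
    fun U hU => mem_entourages_lowerHalf ⟨?_, X.coarse.subset_mem hU.1.2 ?_⟩, fun B hB => ?_⟩
  · rintro _ ⟨_, ⟨p, rfl⟩, rfl⟩
    change |(p.1 : ℝ × X.carrier).1 - 1 - (p.1 : ℝ × X.carrier).1| ≤ 1
    simp
  · rintro _ ⟨_, ⟨_, ⟨p, rfl⟩, rfl⟩, rfl⟩
    rfl
  · obtain ⟨r, hr⟩ := hU.1.1
    refine ⟨r, ?_⟩
    rintro _ ⟨_, hp, rfl⟩
    obtain ⟨n, p, hpU, rfl⟩ := Set.mem_iUnion.1 hp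
    have := hr _ ⟨p, hpU, rfl⟩
    dsimp only [Prod.map] at this ⊢
    rw [lowerShift_iterate, lowerShift_iterate]
    rwa [sub_sub_sub_cancel_right]
  · rintro _ ⟨_, ⟨_, hp, rfl⟩, rfl⟩
    obtain ⟨n, p, hpU, rfl⟩ := Set.mem_iUnion.1 hp
    refine ⟨_, ⟨p, hpU, rfl⟩, ?_⟩
    dsimp only [Prod.map]
    rw [lowerShift_iterate, lowerShift_iterate]
  · have hB' := (Bornology.isBounded_image_fst_and_snd.2
      (Bornology.isBounded_image_subtype_val.2 hB)).1
    obtain ⟨c, hc⟩ := hB'.bddBelow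
    obtain ⟨n, hn⟩ := exists_nat_gt (-c)
    refine ⟨n, Set.eq_empty_iff_forall_notMem.2 ?_⟩
    rintro _ ⟨⟨p, rfl⟩, hp⟩
    have h₁ := hc ⟨_, ⟨_, hp, rfl⟩, rfl⟩
    rw [lowerShift_iterate] at h₁
    have h₂ : (p.1 : ℝ × X.carrier).1 ≤ 0 := p.2.1
    dsimp only at h₁
    linarith

theorem lowerHalfVanishes (E : CoarseHomologyTheory.{w, u, v} G) (X : GUBC.{w, u} G) :
    LowerHalfVanishes E.functor X := fun n =>
  Spectrum.toCofib_bijective _ n (E.flasque _ (isFlasque_lowerHalf X))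

theorem coneComparison_bijective (E : CoarseHomologyTheory.{w, u, v} G) (X : GUBC.{w, u} G)
    (h : LowerHalfVanishes E.functor X) (n : ℤ) :
    Function.Bijective (coneComparison E.functor X h n) :=
  (Equiv.bijective _).comp (coneSquare_isCocartesian E X n)

end Cones

/-! ## Abstract boundary value problems -/

section BoundaryValueProblems

variable {G : Type w} [Group G]

/-- If `M_∞` is isomorphic to `[0, ∞) ⊗ M`, then `W_∞` retracts onto `W`. -/
theorem exists_retraction {X : GUBC.{w, u} G} {Minf W : SubMulAction G X.carrier}
    (hcoarse : IsCoarselyExcisive X.toGBornCoarse Minf W) (huniform : IsUniformlyExcisive X Minf W)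
    (e : X.sub Minf ≅ halfTensor (X.sub (Minf ⊓ W)))
    (he : ∀ m : (X.sub (Minf ⊓ W)).carrier,
      (e.hom.toFun ⟨m.1, m.2.1⟩).1 = ((0, m) : ℝ × (X.sub (Minf ⊓ W)).carrier)) :
    ∃ r : X.carrier → X.carrier, (∀ (g : G) x, r (g • x) = g • r x) ∧ (∀ x, r x ∈ W) ∧
      (∀ x ∈ Minf, r x ∈ Minf) ∧ IsCoarseRetraction X.toGBornCoarse W r ∧
      IsUniformRetraction X W r := by
  classical
  let M := X.sub (Minf ⊓ W)
  let k : Minf → ℝ × M.carrier := fun x => (e.hom.toFun x).1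
  have hk0 : ∀ x, 0 ≤ (k x).1 := fun x => (e.hom.toFun x).2
  let l : ∀ p : ℝ × M.carrier, 0 ≤ p.1 → Minf := fun p hp => e.inv.toFun ⟨p, hp⟩
  have hlk : ∀ x, l (k x) (hk0 x) = x := fun x =>
    congrArg (fun f : X.sub Minf ⟶ X.sub Minf => f.toFun x) e.hom_inv_id
  have hkM : ∀ x (h : x ∈ Minf) (h' : x ∈ W), k ⟨x, h⟩ = (0, ⟨x, h, h'⟩) := fun x h h' =>
    he ⟨x, h, h'⟩
  have hl0 : ∀ m : M.carrier, l (0, m) le_rfl = ⟨m.1, m.2.1⟩ := fun m => by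
    rw [← hlk ⟨m.1, m.2.1⟩]
    congr 1
    exact (hkM m.1 m.2.1 m.2.2).symm
  have hkg : ∀ (g : G) x, k (g • x) = ((k x).1, g • (k x).2) := fun g x =>
    congrArg Subtype.val (e.hom.equivariant g x)
  -- On `M_∞ ≅ [0, ∞) ⊗ M` the radial coordinate is forgotten; elsewhere `r` is the identity. By
  -- `he` the map `r` fixes `W` pointwise.
  let r : X.carrier → X.carrier := fun x => if h : x ∈ Minf then (k ⟨x, h⟩).2.1 else x
  have hrM : ∀ x (h : x ∈ Minf), r x = (k ⟨x, h⟩).2.1 := fun x h => dif_pos h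
  have hrn : ∀ x, x ∉ Minf → r x = x := fun x h => dif_neg h
  have hrW : ∀ x ∈ W, r x = x := by
    intro x hx
    by_cases h : x ∈ Minf
    · rw [hrM x h, hkM x h hx]
    · exact hrn x h
  have hcov : ∀ x, x ∈ Minf ∨ x ∈ W := fun x =>
    (hcoarse.1.symm ▸ trivial : x ∈ Minf ⊔ W)
  have hrl : ∀ x (h : x ∈ Minf), r x = (l (0, (k ⟨x, h⟩).2) le_rfl).1 := fun x h => by
    rw [hrM x h, hl0]
  refine ⟨r, fun g x => ?_, fun x => ?_, fun x hx => ?_, fun U hU => ?_, fun Q hQ => ?_⟩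
  · by_cases h : x ∈ Minf
    · rw [hrM x h, hrM (g • x) (Minf.smul_mem g h)]
      exact congrArg (fun p : ℝ × M.carrier => p.2.1) (hkg g ⟨x, h⟩)
    · rw [hrn x h, hrn]
      exact fun h' => h (by simpa using Minf.smul_mem g⁻¹ h')
  · by_cases h : x ∈ Minf
    · rw [hrM x h]
      exact (k ⟨x, h⟩).2.2.2
    · rw [hrn x h]
      exact (hcov x).resolve_left h
  · rw [hrM x hx]
    exact (k ⟨x, hx⟩).2.2.1
  · obtain ⟨V, hV, hUV⟩ := hcoarse.2 _ (X.coarse.union_mem hU X.coarse.diag_mem)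
    -- Since `M` has height `0`, the bound `R` limits the height of points of `M_∞` that are
    -- `V`-close to `M`.
    obtain ⟨⟨R, hR⟩, -⟩ := e.hom.controlled (Prod.map Subtype.val Subtype.val ⁻¹' V)
      (X.coarse.subset_mem hV (Set.image_preimage_subset _ _))
    -- Pairs of a point of height at most `R` and its projection to height `0`. Transported by
    -- `e.inv`, they contain the pairs `(r x, x)` for `x` near `W` but outside `W`.
    let D : Set ((halfTensor M).carrier × (halfTensor M).carrier) :=
      {p | (p.1.1 : ℝ × M.carrier) = (0, (p.2.1 : ℝ × M.carrier).2) ∧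
        |(p.2.1 : ℝ × M.carrier).1| ≤ R}
    have hD : D ∈ (halfTensor M).coarse.entourages := by
      refine ⟨⟨R, ?_⟩, M.coarse.subset_mem M.coarse.diag_mem ?_⟩
      · rintro _ ⟨p, hp, rfl⟩
        change |(p.1.1 : ℝ × M.carrier).1 - (p.2.1 : ℝ × M.carrier).1| ≤ R
        rw [hp.1, zero_sub, abs_neg]
        exact hp.2
      · rintro _ ⟨_, ⟨p, hp, rfl⟩, rfl⟩
        have h := congrArg (Prod.snd : ℝ × M.carrier → M.carrier) hp.1
        exact h
    refine X.coarse.subset_mem (X.coarse.union_mem X.coarse.diag_mem (e.inv.controlled D hD)) ?_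
    rintro _ ⟨x, ⟨y, hy, hxy⟩, rfl⟩
    by_cases hx : x ∈ W
    · exact Or.inl (hrW x hx)
    · have hxM := (hcov x).resolve_right hx
      obtain ⟨m, hm, hxm⟩ := hUV ⟨⟨x, hxM, Or.inr rfl⟩, ⟨y, hy, Or.inl hxy⟩⟩
      have h₁ := hR _ ⟨_, ⟨(⟨x, hxM⟩, ⟨m, hm.1⟩), hxm, rfl⟩, rfl⟩
      change |(k ⟨x, hxM⟩).1 - (k ⟨m, hm.1⟩).1| ≤ R at h₁
      rw [hkM m hm.1 hm.2, sub_zero] at h₁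
      refine Or.inr ⟨(l (0, (k ⟨x, hxM⟩).2) le_rfl, l (k ⟨x, hxM⟩) (hk0 _)),
        ⟨(⟨(0, (k ⟨x, hxM⟩).2), le_refl (0 : ℝ)⟩, ⟨k ⟨x, hxM⟩, hk0 _⟩), ⟨rfl, h₁⟩, rfl⟩, ?_⟩
      exact Prod.ext (hrl x hxM).symm (congrArg Subtype.val (hlk ⟨x, hxM⟩))
  · have h₁ := e.inv.uniformContinuous (Filter.preimage_mem_comap hQ)
    obtain ⟨T, hT, hTQ⟩ := Filter.mem_comap.1 h₁
    replace hT : T ∈ uniformity (ℝ × M.carrier) := hT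
    rw [uniformity_prod_eq_comap_prod] at hT
    obtain ⟨T', hT', hT'T⟩ := Filter.mem_comap.1 hT
    obtain ⟨A, hA, B, hB, hAB⟩ := Filter.mem_prod_iff.1 hT'
    -- Points of `M_∞` that are `V`-close to `M` have height `A`-close to `0`, by uniform continuity
    -- of the height. Lowering the height to `0` then moves them by less than `Q`, by uniform
    -- continuity of `e.inv`. The inverse of `A` is used to get the pair in the order `(0, height)`.
    have hkc : UniformContinuous fun x => (k x).1 :=
      uniformContinuous_fst.comp (uniformContinuous_subtype_val.comp e.hom.uniformContinuous)
    obtain ⟨V, hV, hVA⟩ := Filter.mem_comap.1 (hkc (symm_le_uniformity hA))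
    obtain ⟨U, hU, hUV⟩ := huniform.2 V hV
    refine ⟨U, hU, ?_⟩
    rintro x ⟨y, hy, hxy⟩
    by_cases hx : x ∈ W
    · rw [hrW x hx]
      exact refl_mem_uniformity hQ
    · have hxM := (hcov x).resolve_right hx
      obtain ⟨m, hm, hxm⟩ := hUV ⟨⟨x, hxM, refl_mem_uniformity hU⟩, ⟨y, hy, hxy⟩⟩
      have h₂ := @hVA (⟨x, hxM⟩, ⟨m, hm.1⟩) hxm
      change ((k ⟨m, hm.1⟩).1, (k ⟨x, hxM⟩).1) ∈ A at h₂
      rw [hkM m hm.1 hm.2] at h₂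
      have h₃ : (l (0, (k ⟨x, hxM⟩).2) le_rfl, l (k ⟨x, hxM⟩) (hk0 _)) ∈
          Prod.map Subtype.val Subtype.val ⁻¹' Q :=
        @hTQ (⟨(0, (k ⟨x, hxM⟩).2), le_refl (0 : ℝ)⟩, ⟨k ⟨x, hxM⟩, hk0 _⟩)
          (hT'T (hAB ⟨h₂, refl_mem_uniformity hB⟩))
      rw [hlk] at h₃
      rw [hrl x hxM]
      exact h₃

/-! ### The three cocartesian squares with total space `Y`. -/

variable (E : CoarseHomologyTheory.{w, u, v} G) {X : GUBC.{w, u} G}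
  {Minf W : SubMulAction G X.carrier} {r : X.carrier → X.carrier}

theorem indexSquare_isCocartesian (hrg : ∀ (g : G) x, r (g • x) = g • r x) (hrW : ∀ x, r x ∈ W)
    (hr : IsCoarseRetraction X.toGBornCoarse W r) :
    IsCocartesian E.functor (indexSquare X W) := by
  refine E.isCocartesian_inclusion _ _ _ (isCoarseEmbedding_subZero X W _ _) le_rfl
    (fun x hx hx' => ?_) (lowerRetraction X r) (fun g x => Prod.ext rfl (hrg g _))
    (fun x _ => ⟨(min_le_right _ _ : min (x : ℝ × X.carrier).1 0 ≤ 0), hrW _⟩) (fun x hx =>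
      ⟨(le_min hx.1 le_rfl : (0 : ℝ) ≤ min (x : ℝ × X.carrier).1 0), trivial⟩) hr.lower
  exact ⟨⟨(x : ℝ × X.carrier).2, hx.2⟩, Subtype.ext (Prod.ext (le_antisymm hx'.1 hx.1) rfl)⟩

/-- The cylinder retraction onto `ℝ × W` preserves `[0, ∞) × M_∞` because `r` preserves `M_∞`. -/
theorem rhoSquare_isCocartesian (hcover : Minf ⊔ W = ⊤)
    (hrg : ∀ (g : G) x, r (g • x) = g • r x) (hrW : ∀ x, r x ∈ W)
    (hrM : ∀ x ∈ Minf, r x ∈ Minf) (hr : IsCoarseRetraction X.toGBornCoarse W r)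
    (hr' : IsUniformRetraction X W r) : IsCocartesian E.functor (rhoSquare X Minf W) := by
  refine E.isCocartesian_inclusion _ _ _ (isCoarseEmbedding_subCone X (Minf ⊓ W) _ _)
    (fun x hx => ?_) (fun x hx hx' => ?_) (cylinderRetraction X r)
    (fun g x => Prod.ext rfl (hrg g _)) (fun x _ => ⟨trivial, hrW _⟩)
    (fun x hx => ⟨hx.1, hrM _ hx.2⟩) (hr.cylinder hr')
  · rcases hx with hx | hx
    · exact Or.inl ⟨trivial, hx.2⟩
    · have : (x : ℝ × X.carrier).2 ∈ Minf ⊔ W := hcover.symm ▸ trivial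
      exact this.symm.imp (fun h => ⟨trivial, h⟩) (fun h => ⟨hx.1, h⟩)
  · exact ⟨⟨((x : ℝ × X.carrier).1, ⟨(x : ℝ × X.carrier).2, hx'.2, hx.2⟩), hx'.1, trivial⟩, rfl⟩

/-- The square with corners `𝒪(W)`, `ℝ × W`, `[0, ∞) × X` and `Y`. -/
theorem cylinderSquare (X : GUBC.{w, u} G) (W : SubMulAction G X.carrier) :
    subCone X W (slab X Set.univ W) (slab_le_slab X (Set.subset_univ _) le_rfl) ≫
      GBornCoarse.inclusion (univ_slab_le_bvpY X W) =
    subCone X W (slab X (Set.Ici 0) ⊤) (slab_le_slab X subset_rfl le_top) ≫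
      GBornCoarse.inclusion (le_sup_right : slab X (Set.Ici 0) ⊤ ≤ bvpY X W) :=
  rfl

theorem cylinderSquare_isCocartesian (hrg : ∀ (g : G) x, r (g • x) = g • r x)
    (hrW : ∀ x, r x ∈ W) (hr : IsCoarseRetraction X.toGBornCoarse W r)
    (hr' : IsUniformRetraction X W r) : IsCocartesian E.functor (cylinderSquare X W) := by
  refine E.isCocartesian_inclusion _ _ _ (isCoarseEmbedding_subCone X W _ _)
    (fun x hx => ?_) (fun x hx hx' => ?_) (cylinderRetraction X r)
    (fun g x => Prod.ext rfl (hrg g _)) (fun x _ => ⟨trivial, hrW _⟩)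
    (fun x hx => ⟨hx.1, trivial⟩) (hr.cylinder hr')
  · exact hx.imp (fun h => ⟨trivial, h.2⟩) id
  · exact ⟨⟨((x : ℝ × X.carrier).1, ⟨(x : ℝ × X.carrier).2, hx.2⟩), hx'.1, trivial⟩, rfl⟩

end BoundaryValueProblems

end

end CoarseAPS

theorem mainTheorem2 {G : Type w} [Group G]
    (E : CoarseAPS.CoarseHomologyTheory.{w, u, v} G)
    (X : CoarseAPS.GUBC.{w, u} G) (Minf W : SubMulAction G X.carrier)
    (hcoarse : CoarseAPS.IsCoarselyExcisive X.toGBornCoarse Minf W)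
    (huniform : CoarseAPS.IsUniformlyExcisive X Minf W)
    (e : X.sub Minf ≅ CoarseAPS.halfTensor (X.sub (Minf ⊓ W)))
    (he : ∀ m : (X.sub (Minf ⊓ W)).carrier,
      (e.hom.toFun ⟨m.1, m.2.1⟩).1 = ((0, m) : ℝ × (X.sub (Minf ⊓ W)).carrier))
    (hf : CoarseAPS.IsCoarseEquivalence (CoarseAPS.GUBC.forget
      (CoarseAPS.GUBC.inclusion (X := X) (inf_le_right : Minf ⊓ W ≤ W)))) :
    ∃ (h : CoarseAPS.LowerHalfVanishes E.functor X)
      (hc : ∀ n : ℤ, Function.Bijective (CoarseAPS.coneComparison E.functor X h n))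
      (hind : CoarseAPS.IsCocartesian E.functor (CoarseAPS.indexSquare X W))
      (hrho : CoarseAPS.IsCocartesian E.functor (CoarseAPS.rhoSquare X Minf W)),
      ∀ (n : ℤ) (σ : CoarseAPS.Symbol E.functor X n)
        (bdc : CoarseAPS.HPi E.functor (n + 1)
          ((CoarseAPS.coneMinus X).sub (CoarseAPS.bvpY X W))),
        CoarseAPS.IsBoundaryCondition E.functor X W h hc σ bdc →
        CoarseAPS.hMap E.functor n
            (CoarseAPS.coneMap (CoarseAPS.GUBC.inclusion (X := X)
              (inf_le_right : Minf ⊓ W ≤ W)))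
            (CoarseAPS.rhoInvariant E.functor X Minf W hrho bdc) =
          CoarseAPS.hMap E.functor n (CoarseAPS.coneZero (X.sub W))
            (CoarseAPS.bvpIndex E.functor X W hind bdc) := by
  obtain ⟨r, hrg, hrW, hrM, hr, hr'⟩ :=
    CoarseAPS.exists_retraction hcoarse huniform e he
  have hind := CoarseAPS.indexSquare_isCocartesian E hrg hrW hr
  have hrho := CoarseAPS.rhoSquare_isCocartesian E hcoarse.1 hrg hrW hrM hr hr'
  have hcyl := CoarseAPS.cylinderSquare_isCocartesian E hrg hrW hr hr'
  refine ⟨CoarseAPS.lowerHalfVanishes E X, CoarseAPS.coneComparison_bijective E X _, hind, hrho,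
    fun n σ bdc _ => ?_⟩
  -- `φ ∘ ∂' = ∂''`: the first piece `ℝ × W` is kept and `M_∞` grows to `W_∞` in the second.
  refine (CoarseAPS.hMap_mvBoundary E.functor n _ hrho (CoarseAPS.cylinderSquare X W) hcyl
    _ (𝟙 _) (CoarseAPS.GBornCoarse.inclusion
      (CoarseAPS.slab_le_slab X subset_rfl le_top)) rfl rfl rfl rfl bdc).trans ?_
  -- `ψ ∘ ∂ = ∂''`: the second piece is kept and `(-∞, 0] × W` grows to `ℝ × W`.
  exact (CoarseAPS.hMap_mvBoundary E.functor n _ hind (CoarseAPS.cylinderSquare X W) hcyl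
    _ (CoarseAPS.GBornCoarse.inclusion
      (CoarseAPS.slab_le_slab X (Set.subset_univ _) le_rfl)) (𝟙 _) rfl rfl rfl rfl bdc).symm
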